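/- Let $d\ge 1$ and $m\ge 0$ be integers, let $A\subset\mathbb R^m$ be compact, and let $T>0$. Let $c(t,x,a)\in\mathbb R$ and $f(t,x,a)\in\mathbb R^d$ be defined for $(t,x,a)\in[0,T]\times\mathbb R^d\times A$, and let $q:\mathbb R^d\to\mathbb R$. Assume that $c,f,q$ are bounded by a constant $K$ and are Lipschitz continuous in all variables with constant $K$. Assume also that for all $(t,x,p)\in[0,T]\times\mathbb R^d\times\mathbb R^d$ the function $a\mapsto c(t,x,a)+p\cdot f(t,x,a)$ has a unique minimizer $\alpha(t,x,p)$ over $A$, and that $\alpha$ is Lipschitz continuous in all variables with constant $K$. Put $$H(t,x,p)=\min_{a\in A}\,[\,c(t,x,a)+p\cdot f(t,x,a)\,].$$ Let $v$ be the bounded continuous viscosity solution on $[0,T]\times\mathbb R^d$ of $$\partial_t v+H(t,x,\nabla v)=0\ \text{ in }(0,T)\times\mathbb R^d,\qquad v(T,\cdot)=q .$$ Let $\tau,h\in(0,1)$ with $T/\tau$ a positive integer, and let $N$ be a real number satisfying the CFL-type condition $$\max\{1,\|f\|_\infty/2\}\ \le\ N\ \le\ \frac{h}{2d\tau}.$$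 On the grid $\Omega^{\tau,h}_T=\{0,\tau,2\tau,\dots,T\}\times h\mathbb Z^d$ let $V=V^{\tau,h}$ be the solution of $$\frac{V(t,x)-V(t-\tau,x)}{\tau}+H\big(t,x,\nabla^hV(t,x)\big)=-Nh\,\Delta^hV(t,x)\quad (t\ne 0),\qquad V(T,x)=q(x),$$ where $$\nabla^h\varphi(x)=\Big(\frac{\varphi(x+he_i)-\varphi(x-he_i)}{2h}\Big)_{i=1}^d,\qquad \Delta^h\varphi(x)=\sum_{i=1}^d\frac{\varphi(x+he_i)-2\varphi(x)+\varphi(x-he_i)}{h^2}.$$ Then $v$ is Lipschitz continuous in $x$, uniformly in $t\in[0,T]$, and there is a constant $C>0$ depending only on $d$, $N$ and $K$ such that $$\sup_{(t,x)\in\Omega^{\tau,h}_T}|v(t,x)-V^{\tau,h}(t,x)|\le C(1+T)(1+\|\nabla v\|_\infty)\sqrt h$$ and $$\sup_{(t,x)\in\Omega^{\tau,h}_T}|v(t,x)-V^{\tau,h}(t,x)|\le C e^{CT}\sqrt h .$$ Here $\|\nabla v\|_\infty$ is the supremum of $|\nabla v(t,x)|$ over the points of $[0,T]\times\mathbb R^d$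 at which $v(t,\cdot)$ is differentiable. -/

import Mathlib

open Set
open scoped InnerProductSpace Gradient

noncomputable section

namespace HJB

/-- `ℝ^d` with its Euclidean norm. -/
abbrev Eucl (d : ℕ) : Type := EuclideanSpace ℝ (Fin d)

/-- The Hamiltonian `H(t,x,p) = inf_{a ∈ A} [c(t,x,a) + p · f(t,x,a)]`. -/
def hamiltonian {d m : ℕ} (A : Set (Eucl m)) (c : ℝ → Eucl d → Eucl m → ℝ)
    (f : ℝ → Eucl d → Eucl m → Eucl d) (t : ℝ) (x p : Eucl d) : ℝ :=
  ⨅ a : A, (c t x a + ⟪p, f t x a⟫_ℝ)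

/-- The running cost `c`, the drift `f` and the terminal cost `q` are bounded by `K` and
Lipschitz continuous with constant `K` in all variables, on `[0,T] × ℝ^d × A`. -/
structure DataBounds {d m : ℕ} (T K : ℝ) (A : Set (Eucl m)) (c : ℝ → Eucl d → Eucl m → ℝ)
    (f : ℝ → Eucl d → Eucl m → Eucl d) (q : Eucl d → ℝ) : Prop where
  c_bound : ∀ t ∈ Icc (0 : ℝ) T, ∀ x, ∀ a ∈ A, |c t x a| ≤ K
  f_bound : ∀ t ∈ Icc (0 : ℝ) T, ∀ x, ∀ a ∈ A, ‖f t x a‖ ≤ K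
  q_bound : ∀ x, |q x| ≤ K
  c_lip : ∀ t ∈ Icc (0 : ℝ) T, ∀ s ∈ Icc (0 : ℝ) T, ∀ x y, ∀ a ∈ A, ∀ b ∈ A,
    |c t x a - c s y b| ≤ K * (|t - s| + ‖x - y‖ + ‖a - b‖)
  f_lip : ∀ t ∈ Icc (0 : ℝ) T, ∀ s ∈ Icc (0 : ℝ) T, ∀ x y, ∀ a ∈ A, ∀ b ∈ A,
    ‖f t x a - f s y b‖ ≤ K * (|t - s| + ‖x - y‖ + ‖a - b‖)
  q_lip : ∀ x y, |q x - q y| ≤ K * ‖x - y‖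

/-- `α(t,x,p)` is the unique minimizer over `A` of `a ↦ c(t,x,a) + p · f(t,x,a)`, and it is
Lipschitz continuous in all variables with constant `K`. -/
structure IsLipschitzArgmin {d m : ℕ} (T K : ℝ) (A : Set (Eucl m))
    (c : ℝ → Eucl d → Eucl m → ℝ) (f : ℝ → Eucl d → Eucl m → Eucl d)
    (α : ℝ → Eucl d → Eucl d → Eucl m) : Prop where
  mem : ∀ t ∈ Icc (0 : ℝ) T, ∀ x p, α t x p ∈ A
  lt : ∀ t ∈ Icc (0 : ℝ) T, ∀ x p, ∀ a ∈ A, a ≠ α t x p →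
    c t x (α t x p) + ⟪p, f t x (α t x p)⟫_ℝ < c t x a + ⟪p, f t x a⟫_ℝ
  lip : ∀ t ∈ Icc (0 : ℝ) T, ∀ s ∈ Icc (0 : ℝ) T, ∀ x y p r,
    ‖α t x p - α s y r‖ ≤ K * (|t - s| + ‖x - y‖ + ‖p - r‖)

/-- `v` is a bounded continuous viscosity solution on `[0,T] × ℝ^d` of the terminal value problem
`∂_t v + H(t,x,∇v) = 0` in `(0,T) × ℝ^d`, `v(T,·) = q`. Since data are prescribed at the final
time, a test function touching from above (`v - φ` has a local maximum) satisfies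
`∂_t φ + H ≥ 0`, and one touching from below satisfies `∂_t φ + H ≤ 0`. -/
structure IsViscositySolution {d : ℕ} (T : ℝ) (H : ℝ → Eucl d → Eucl d → ℝ) (q : Eucl d → ℝ)
    (v : ℝ → Eucl d → ℝ) : Prop where
  cont : ContinuousOn (fun z : ℝ × Eucl d => v z.1 z.2) (Icc (0 : ℝ) T ×ˢ univ)
  bounded : ∃ B : ℝ, ∀ t ∈ Icc (0 : ℝ) T, ∀ x, |v t x| ≤ B
  terminal : ∀ x, v T x = q x
  sub : ∀ φ : ℝ × Eucl d → ℝ, ContDiff ℝ 1 φ → ∀ t ∈ Ioo (0 : ℝ) T, ∀ x,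
    IsLocalMax (fun z : ℝ × Eucl d => v z.1 z.2 - φ z) (t, x) →
      0 ≤ deriv (fun s => φ (s, x)) t + H t x (∇ (fun y => φ (t, y)) x)
  super : ∀ φ : ℝ × Eucl d → ℝ, ContDiff ℝ 1 φ → ∀ t ∈ Ioo (0 : ℝ) T, ∀ x,
    IsLocalMin (fun z : ℝ × Eucl d => v z.1 z.2 - φ z) (t, x) →
      deriv (fun s => φ (s, x)) t + H t x (∇ (fun y => φ (t, y)) x) ≤ 0

/-- The sup norm `‖∇v‖_∞` over `[0,T] × ℝ^d` of the spatial gradient (points where `v(t,·)` is not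
differentiable contribute `0`). It is meaningful when the functions `v(t,·)` are uniformly
Lipschitz: they are then differentiable almost everywhere, and this is their best common
Lipschitz constant. -/
def gradSup {d : ℕ} (T : ℝ) (v : ℝ → Eucl d → ℝ) : ℝ :=
  ⨆ z : Icc (0 : ℝ) T × Eucl d, ‖∇ (v z.1) z.2‖

/-- The central difference gradient `∇^h`. -/
def discGrad {d : ℕ} (h : ℝ) (φ : Eucl d → ℝ) (x : Eucl d) : Eucl d :=
  WithLp.toLp 2 fun i => (φ (x + h • EuclideanSpace.single i (1 : ℝ))
    - φ (x - h • EuclideanSpace.single i (1 : ℝ))) / (2 * h)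

/-- The discrete Laplacian `Δ^h`. -/
def discLaplacian {d : ℕ} (h : ℝ) (φ : Eucl d → ℝ) (x : Eucl d) : ℝ :=
  ∑ i, (φ (x + h • EuclideanSpace.single i (1 : ℝ)) - 2 * φ x
    + φ (x - h • EuclideanSpace.single i (1 : ℝ))) / h ^ 2

/-- The time grid `{0, τ, 2τ, …, T}` (for `T / τ` a positive integer). -/
def timeGrid (T τ : ℝ) : Set ℝ := {t | t ∈ Icc 0 T ∧ ∃ k : ℕ, t = k * τ}

/-- The space grid `h ℤ^d`. -/
def spaceGrid (d : ℕ) (h : ℝ) : Set (Eucl d) := {x | ∀ i, ∃ z : ℤ, x i = h * z}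

/-- `V` solves the explicit scheme `∂_t^τ V + H(t,x,∇^h V) = - N h Δ^h V` for all grid points with
`t ≠ 0`, and `V(T,·) = q` on `h ℤ^d`. Only the values of `V` on the grid matter. -/
structure IsSchemeSolution {d : ℕ} (T τ h N : ℝ) (H : ℝ → Eucl d → Eucl d → ℝ)
    (q : Eucl d → ℝ) (V : ℝ → Eucl d → ℝ) : Prop where
  eqn : ∀ t ∈ timeGrid T τ \ {0}, ∀ x ∈ spaceGrid d h,
    (V t x - V (t - τ) x) / τ + H t x (discGrad h (V t) x) = - N * h * discLaplacian h (V t) x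
  terminal : ∀ x ∈ spaceGrid d h, V T x = q x

end HJB

end

namespace HJB

/-! The CFL condition makes an explicit step monotone, and a step commutes with adding constants.
The resulting discrete comparison (`step_mono`, `step_add_const`) gives the scheme a bounded speed
near the terminal time and a spatial Lipschitz constant of order `exp (K d T)`, both independent of
the mesh.

The error is estimated by doubling variables: `v(t,x) - U(k,z)` is maximized after subtracting
quadratic penalties with parameter `ε = √h / (1 + L)`. If the maximum had `t < T`, the viscosity
inequality for `v` and the scheme inequality for `U`, tested with the same quadratic, would differ
only by consistency errors of order `(1 + L) √h`; the term `l (T - t)` is steep enough to forbid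
this. At `t = T` the maximum is controlled by the Lipschitz bound for `q` and the speed of the
scheme. A shift `κ` of order `√h` in the discrete time rules out `k = n` with `t < T`.

Only one of `v` and `U` has to be `L`-Lipschitz in space (`norm_sub_le_of_max`). Taking `L = ‖∇v‖_∞`
gives the first estimate, the Lipschitz constant of the scheme gives the second. The latter
presupposes no regularity of `v`, so it exhibits `v` as a limit of uniformly Lipschitz lattice
functions, and `v` is Lipschitz. The opposite one-sided bounds follow by changing signs. -/

/-- Growth and regularity of a Hamiltonian on `[0,T]`: growth and Lipschitz constant `K(1+|p|)`,
and Lipschitz continuity in `p` for the `ℓ¹` norm with constant `2N`. -/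
structure HamiltonianBounds {d : ℕ} (T K N : ℝ) (H : ℝ → Eucl d → Eucl d → ℝ) : Prop where
  bound : ∀ t ∈ Icc (0 : ℝ) T, ∀ x p, |H t x p| ≤ K * (1 + ‖p‖)
  lip : ∀ t ∈ Icc (0 : ℝ) T, ∀ s ∈ Icc (0 : ℝ) T, ∀ x y p,
    |H t x p - H s y p| ≤ K * (1 + ‖p‖) * (|t - s| + ‖x - y‖)
  lip_momentum : ∀ t ∈ Icc (0 : ℝ) T, ∀ x p r,
    |H t x p - H t x r| ≤ 2 * N * ∑ i, |p i - r i|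

/-- The point `h z` of the grid `h ℤ^d`. -/
noncomputable def gridPoint {d : ℕ} (h : ℝ) (z : Fin d → ℤ) : Eucl d :=
  WithLp.toLp 2 fun i => h * z i

/-- The central difference gradient of a lattice function. -/
noncomputable def latGrad {d : ℕ} (h : ℝ) (g : (Fin d → ℤ) → ℝ) (z : Fin d → ℤ) : Eucl d :=
  WithLp.toLp 2 fun i => (g (z + Pi.single i 1) - g (z - Pi.single i 1)) / (2 * h)

/-- The discrete Laplacian of a lattice function. -/
noncomputable def latLap {d : ℕ} (h : ℝ) (g : (Fin d → ℤ) → ℝ) (z : Fin d → ℤ) : ℝ :=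
  ∑ i, (g (z + Pi.single i 1) - 2 * g z + g (z - Pi.single i 1)) / h ^ 2

/-- One explicit step of the scheme, for lattice functions. -/
noncomputable def step {d : ℕ} (τ h N : ℝ) (H : ℝ → Eucl d → Eucl d → ℝ) (t : ℝ)
    (g : (Fin d → ℤ) → ℝ) (z : Fin d → ℤ) : ℝ :=
  g z + τ * (H t (gridPoint h z) (latGrad h g z) + N * h * latLap h g z)

/-- A solution of the scheme, indexed by `ℕ × ℤ^d`, with terminal time `n τ`. -/
structure IsLatticeSolution {d : ℕ} (n : ℕ) (τ h N : ℝ) (H : ℝ → Eucl d → Eucl d → ℝ)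
    (q : Eucl d → ℝ) (U : ℕ → (Fin d → ℤ) → ℝ) : Prop where
  eqn : ∀ k < n, ∀ z, U k z = step τ h N H ((k + 1 : ℕ) * τ) (U (k + 1)) z
  terminal : ∀ z, U n z = q (gridPoint h z)

/-- The conditions on the discretization parameters. -/
structure Parameters (d n : ℕ) (T τ h N : ℝ) : Prop where
  one_le_d : 1 ≤ d
  one_le_N : 1 ≤ N
  τ_pos : 0 < τ
  h_pos : 0 < h
  h_le : h ≤ 1
  T_eq : T = n * τ
  cfl : 2 * d * τ * N ≤ h

/-! ### The scheme on the lattice: monotonicity, speed, Lipschitz bound. -/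

section Lattice

variable {d : ℕ}

theorem gridPoint_add (h : ℝ) (z w : Fin d → ℤ) :
    gridPoint h (z + w) = gridPoint h z + gridPoint h w := by
  ext i; simp [gridPoint, mul_add]

theorem gridPoint_single (h : ℝ) (i : Fin d) :
    gridPoint h (Pi.single i 1) = h • EuclideanSpace.single i (1 : ℝ) := by
  ext j
  by_cases hj : j = i
  · subst hj; simp [gridPoint]
  · simp [gridPoint, hj]

theorem gridPoint_neg (h : ℝ) (z : Fin d → ℤ) : gridPoint h (-z) = -gridPoint h z := by
  ext i; simp [gridPoint]

theorem gridPoint_sub (h : ℝ) (z w : Fin d → ℤ) :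
    gridPoint h (z - w) = gridPoint h z - gridPoint h w := by
  rw [sub_eq_add_neg, gridPoint_add, gridPoint_neg, sub_eq_add_neg]

theorem norm_gridPoint_single {h : ℝ} (hh : 0 ≤ h) (i : Fin d) :
    ‖gridPoint h (Pi.single i 1)‖ = h := by
  rw [gridPoint_single, norm_smul]; simp [abs_of_nonneg hh]

theorem norm_le_of_coord_le {x : Eucl d} {b : ℝ} (hx : ∀ i, |x i| ≤ b) : ‖x‖ ≤ d * b := by
  have h1 : ‖x‖ ≤ ∑ i, |x i| := by
    have hb : x = ∑ i, x i • EuclideanSpace.single i (1 : ℝ) := by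
      ext j
      simp [Finset.sum_apply, Pi.single_apply]
    calc ‖x‖ = ‖∑ i, x i • EuclideanSpace.single i (1 : ℝ)‖ := by rw [← hb]
      _ ≤ ∑ i, ‖x i • EuclideanSpace.single i (1 : ℝ)‖ := norm_sum_le _ _
      _ = ∑ i, |x i| := by simp [norm_smul]
  calc ‖x‖ ≤ ∑ i, |x i| := h1
    _ ≤ ∑ _i : Fin d, b := Finset.sum_le_sum fun i _ => hx i
    _ = d * b := by simp

theorem exists_gridPoint_near {h : ℝ} (hh : 0 < h) (x : Eucl d) :
    ∃ z, ‖x - gridPoint h z‖ ≤ d * h := by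
  refine ⟨fun i => round (x i / h), norm_le_of_coord_le fun i => ?_⟩
  have h1 := abs_sub_round (x i / h)
  have h2 : (x - gridPoint h fun i => round (x i / h)) i
      = h * (x i / h - round (x i / h)) := by
    simp [gridPoint]; field_simp
  rw [h2, abs_mul, abs_of_pos hh]
  nlinarith

theorem norm_latGrad_le {h : ℝ} (hh : 0 < h) {g : (Fin d → ℤ) → ℝ} {L : ℝ}
    (hg : ∀ z w, |g z - g w| ≤ L * ‖gridPoint h z - gridPoint h w‖) (z : Fin d → ℤ) :
    ‖latGrad h g z‖ ≤ d * L := by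
  refine norm_le_of_coord_le fun i => ?_
  have h1 := hg (z + Pi.single i 1) (z - Pi.single i 1)
  rw [gridPoint_add, gridPoint_sub, add_sub_sub_cancel, ← two_smul ℝ (gridPoint h (Pi.single i 1)),
    norm_smul, norm_gridPoint_single hh.le] at h1
  simp only [latGrad, abs_div, abs_of_pos (mul_pos two_pos hh)]
  rw [div_le_iff₀ (by positivity)]
  simpa using h1

/-- Second differences of a Lipschitz function are only `O(L h)`, so its discrete Laplacian may be
of size `1/h`; the factor `h` in the numerical viscosity compensates exactly. -/
theorem abs_latLap_le {h : ℝ} (hh : 0 < h) {g : (Fin d → ℤ) → ℝ} {L : ℝ}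
    (hg : ∀ z w, |g z - g w| ≤ L * ‖gridPoint h z - gridPoint h w‖) (z : Fin d → ℤ) :
    h * |latLap h g z| ≤ 2 * d * L := by
  have key : ∀ i, |(g (z + Pi.single i 1) - 2 * g z + g (z - Pi.single i 1)) / h ^ 2|
      ≤ 2 * L / h := by
    intro i
    have h1 := hg (z + Pi.single i 1) z
    have h2 := hg (z - Pi.single i 1) z
    rw [gridPoint_add, add_sub_cancel_left, norm_gridPoint_single hh.le] at h1
    rw [gridPoint_sub, sub_sub_cancel_left, norm_neg, norm_gridPoint_single hh.le] at h2
    rw [abs_div, abs_of_pos (pow_pos hh 2), div_le_div_iff₀ (by positivity) hh]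
    rw [abs_le] at h1 h2
    have : |g (z + Pi.single i 1) - 2 * g z + g (z - Pi.single i 1)| ≤ 2 * (L * h) :=
      abs_le.2 ⟨by linarith, by linarith⟩
    nlinarith
  have h3 : |latLap h g z| ≤ d * (2 * L / h) := by
    calc |latLap h g z| ≤ _ := Finset.abs_sum_le_sum_abs _ _
      _ ≤ ∑ _i : Fin d, 2 * L / h := Finset.sum_le_sum fun i _ => key i
      _ = d * (2 * L / h) := by simp
  calc h * |latLap h g z| ≤ h * (d * (2 * L / h)) := by gcongr
    _ = 2 * d * L := by field_simp

theorem step_add_const (τ h N : ℝ) (H : ℝ → Eucl d → Eucl d → ℝ) (t : ℝ) (g : (Fin d → ℤ) → ℝ)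
    (b : ℝ) (z : Fin d → ℤ) :
    step τ h N H t (fun w => g w + b) z = step τ h N H t g z + b := by
  have h1 : latGrad h (fun w => g w + b) z = latGrad h g z := by
    ext i; simp [latGrad]
  have h2 : latLap h (fun w => g w + b) z = latLap h g z := by
    refine Finset.sum_congr rfl fun i _ => ?_
    congr 1; ring
  simp only [step, h1, h2]; ring

variable {n : ℕ} {T τ h N K : ℝ} {H : ℝ → Eucl d → Eucl d → ℝ}

/-- For the increment `w = g' - g ≥ 0`, the Hamiltonian can lose at most `N/h` times the sum of the
neighbouring values of `w`, and the viscosity gains exactly that. What remains at the centre is `(1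
- 2dNτ/h) w z`, nonnegative by the CFL condition. -/
theorem step_mono (hp : Parameters d n T τ h N) (hH : HamiltonianBounds T K N H) {t : ℝ}
    (ht : t ∈ Icc 0 T) {g g' : (Fin d → ℤ) → ℝ} (hg : ∀ z, g z ≤ g' z) (z : Fin d → ℤ) :
    step τ h N H t g z ≤ step τ h N H t g' z := by
  have hh := hp.h_pos
  have hN : 0 < N := lt_of_lt_of_le one_pos hp.one_le_N
  set w : (Fin d → ℤ) → ℝ := fun z => g' z - g z with hw
  have hw0 : ∀ z, 0 ≤ w z := fun z => sub_nonneg.2 (hg z)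
  have h1 := (abs_le.1 (hH.lip_momentum t ht (gridPoint h z) (latGrad h g z) (latGrad h g' z))).2
  have h2 : ∑ i, |latGrad h g z i - latGrad h g' z i|
      ≤ ∑ i, (w (z + Pi.single i 1) + w (z - Pi.single i 1)) / (2 * h) := by
    refine Finset.sum_le_sum fun i _ => ?_
    have : latGrad h g z i - latGrad h g' z i
        = (w (z - Pi.single i 1) - w (z + Pi.single i 1)) / (2 * h) := by
      simp only [latGrad, hw]; ring
    rw [this, abs_div, abs_of_pos (mul_pos two_pos hh)]
    gcongr
    have := hw0 (z + Pi.single i 1)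
    have := hw0 (z - Pi.single i 1)
    exact abs_le.2 ⟨by linarith, by linarith⟩
  have h3 : latLap h g' z - latLap h g z
      = ∑ i, (w (z + Pi.single i 1) + w (z - Pi.single i 1)) / h ^ 2 - d * (2 * w z / h ^ 2) := by
    rw [latLap, latLap, ← Finset.sum_sub_distrib]
    have : (d : ℝ) * (2 * w z / h ^ 2) = ∑ _i : Fin d, 2 * w z / h ^ 2 := by simp
    rw [this, ← Finset.sum_sub_distrib]
    refine Finset.sum_congr rfl fun i _ => ?_
    simp only [hw]; ring
  set S : ℝ := ∑ i, (w (z + Pi.single i 1) + w (z - Pi.single i 1)) with hS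
  rw [← Finset.sum_div, ← hS] at h2 h3
  have h4 : H t (gridPoint h z) (latGrad h g z) - H t (gridPoint h z) (latGrad h g' z)
      ≤ N * S / h := by
    calc _ ≤ _ := h1
      _ ≤ 2 * N * (S / (2 * h)) := by gcongr
      _ = N * S / h := by field_simp
  have h5 : N * h * (latLap h g' z - latLap h g z) = N * S / h - 2 * d * N / h * w z := by
    rw [h3]; field_simp
  have h6 : 2 * d * N / h * τ ≤ 1 := by
    rw [div_mul_eq_mul_div, div_le_one hh]; linarith [hp.cfl]
  have h7 : 2 * d * N / h * τ * w z ≤ w z := by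
    simpa using mul_le_mul_of_nonneg_right h6 (hw0 z)
  have h8 : 0 ≤ τ * (H t (gridPoint h z) (latGrad h g' z) - H t (gridPoint h z) (latGrad h g z)
      + N * h * (latLap h g' z - latLap h g z) + 2 * d * N / h * w z) :=
    mul_nonneg hp.τ_pos.le (by linarith)
  have h9 : w z = g' z - g z := rfl
  simp only [step]
  nlinarith

theorem Parameters.mem_Icc (hp : Parameters d n T τ h N) {k : ℕ} (hk : k ≤ n) :
    (k : ℝ) * τ ∈ Icc 0 T := by
  refine ⟨mul_nonneg k.cast_nonneg hp.τ_pos.le, ?_⟩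
  rw [hp.T_eq]
  exact mul_le_mul_of_nonneg_right (by exact_mod_cast hk) hp.τ_pos.le

theorem Parameters.τ_le (hp : Parameters d n T τ h N) : τ ≤ h := by
  have h1 : (1 : ℝ) ≤ d := by exact_mod_cast hp.one_le_d
  have h2 := hp.one_le_N
  have h3 := hp.τ_pos
  have h4 : 1 ≤ d * N := by nlinarith
  nlinarith [hp.cfl]

variable {q : Eucl d → ℝ} {U : ℕ → (Fin d → ℤ) → ℝ}

theorem abs_step_sub_le (hp : Parameters d n T τ h N) (hH : HamiltonianBounds T K N H) (hK : 0 ≤ K)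
    {t : ℝ} (ht : t ∈ Icc 0 T) {g : (Fin d → ℤ) → ℝ} {L : ℝ}
    (hg : ∀ z w, |g z - g w| ≤ L * ‖gridPoint h z - gridPoint h w‖) (z : Fin d → ℤ) :
    |step τ h N H t g z - g z| ≤ τ * (K * (1 + d * L) + 2 * d * N * L) := by
  have hN : 0 < N := lt_of_lt_of_le one_pos hp.one_le_N
  rw [step, add_sub_cancel_left, abs_mul, abs_of_pos hp.τ_pos]
  refine mul_le_mul_of_nonneg_left ?_ hp.τ_pos.le
  refine (abs_add_le _ _).trans (add_le_add ?_ ?_)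
  · refine (hH.bound t ht _ _).trans ?_
    gcongr
    exact norm_latGrad_le hp.h_pos hg z
  · rw [mul_assoc, abs_mul, abs_mul, abs_of_pos hN, abs_of_pos hp.h_pos]
    have := abs_latLap_le hp.h_pos hg z
    nlinarith

/-- The scheme moves away from its terminal data with bounded speed. -/
theorem IsLatticeSolution.abs_sub_terminal_le (hp : Parameters d n T τ h N)
    (hH : HamiltonianBounds T K N H) (hK : 0 ≤ K) (hq : ∀ x y, |q x - q y| ≤ K * ‖x - y‖)
    (hU : IsLatticeSolution n τ h N H q U) {k : ℕ} (hk : k ≤ n) (z : Fin d → ℤ) :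
    |U k z - q (gridPoint h z)| ≤ (K * (1 + d * K) + 2 * d * N * K) * (T - k * τ) := by
  induction hk using Nat.decreasingInduction generalizing z with
  | self => simp [hU.terminal, hp.T_eq]
  | of_succ k hk ih =>
    set C := K * (1 + d * K) + 2 * d * N * K
    set b := C * (T - (k + 1 : ℕ) * τ)
    have ht := hp.mem_Icc (Nat.succ_le_of_lt hk)
    have h1 := abs_le.1 (abs_step_sub_le hp hH hK ht
      (g := fun z => q (gridPoint h z)) (fun z w => hq _ _) z)
    -- The barriers `q ± b` trap `U (k + 1)`; one step keeps the order and moves each barrier by at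
    -- most `τ C`.
    have h2 := step_mono hp hH ht (g := U (k + 1)) (g' := fun z => q (gridPoint h z) + b)
      (fun w => by linarith [(abs_le.1 (ih w)).2]) z
    have h3 := step_mono hp hH ht (g' := U (k + 1)) (g := fun z => q (gridPoint h z) + -b)
      (fun w => by linarith [(abs_le.1 (ih w)).1]) z
    rw [step_add_const] at h2 h3
    have h4 : b = C * (T - k * τ) - τ * C := by simp only [b]; push_cast; ring
    rw [hU.eqn k hk z, abs_le]
    constructor <;> linarith

/-- The scheme is Lipschitz continuous in space. -/
theorem IsLatticeSolution.lipschitz (hp : Parameters d n T τ h N)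
    (hH : HamiltonianBounds T K N H) (hK : 0 ≤ K) (hq : ∀ x y, |q x - q y| ≤ K * ‖x - y‖)
    (hU : IsLatticeSolution n τ h N H q U) {k : ℕ} (hk : k ≤ n) (z w : Fin d → ℤ) :
    |U k z - U k w| ≤ (1 + d * K) * Real.exp (K * d * T) * ‖gridPoint h z - gridPoint h w‖ := by
  have hd : (1 : ℝ) ≤ d := by exact_mod_cast hp.one_le_d
  have hτ := hp.τ_pos
  -- The recursion `L ↦ L + τ K (1 + d L)` multiplies `1 + d L` by `1 + K d τ`, hence this form of
  -- the induction hypothesis.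
  have main : ∃ L : ℝ, 0 ≤ L ∧ 1 + d * L ≤ (1 + d * K) * Real.exp (K * d * (T - k * τ)) ∧
      ∀ z w, |U k z - U k w| ≤ L * ‖gridPoint h z - gridPoint h w‖ := by
    clear z w
    induction hk using Nat.decreasingInduction with
    | self => exact ⟨K, hK, by simp [hp.T_eq], fun z w => by simpa [hU.terminal] using hq _ _⟩
    | of_succ k hk ih =>
      obtain ⟨L, hL, hexp, hlip⟩ := ih
      have ht := hp.mem_Icc (Nat.succ_le_of_lt hk)
      -- The translate of `U (k + 1)` by `e` lies below `U (k + 1)` plus a constant. Translation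
      -- does not commute with the step, and the dependence of `H` on `x` accounts for the extra
      -- term.
      have one : ∀ z e, U k (z + e) ≤ U k z + (L + τ * (K * (1 + d * L))) * ‖gridPoint h e‖ := by
        intro z e
        have h1 := step_mono hp hH ht (g := fun w => U (k + 1) (w + e))
          (g' := fun w => U (k + 1) w + L * ‖gridPoint h e‖) (fun w => by
            have := (abs_le.1 (hlip (w + e) w)).2
            rw [gridPoint_add, add_sub_cancel_left] at this
            linarith) z
        rw [step_add_const, ← hU.eqn k hk z] at h1
        have hgrad : latGrad h (fun w => U (k + 1) (w + e)) z = latGrad h (U (k + 1)) (z + e) := by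
          ext i; simp only [latGrad, add_right_comm, sub_add_eq_add_sub]
        have hlap : latLap h (fun w => U (k + 1) (w + e)) z = latLap h (U (k + 1)) (z + e) := by
          simp only [latLap, add_right_comm, sub_add_eq_add_sub]
        rw [step, hgrad, hlap] at h1
        have h2 := (abs_le.1 (hH.lip _ ht _ ht (gridPoint h (z + e)) (gridPoint h z)
          (latGrad h (U (k + 1)) (z + e)))).2
        rw [gridPoint_add, add_sub_cancel_left, sub_self, abs_zero, zero_add] at h2
        have h3 : K * (1 + ‖latGrad h (U (k + 1)) (z + e)‖) * ‖gridPoint h e‖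
            ≤ K * (1 + d * L) * ‖gridPoint h e‖ := by
          gcongr; exact norm_latGrad_le hp.h_pos hlip _
        have h4 := mul_le_mul_of_nonneg_left (h2.trans h3) hτ.le
        rw [hU.eqn k hk (z + e), step, gridPoint_add]
        nlinarith
      refine ⟨L + τ * (K * (1 + d * L)), by positivity, ?_, fun z w => ?_⟩
      · have e1 : K * d * (T - k * τ) = K * d * τ + K * d * (T - (k + 1 : ℕ) * τ) := by
          push_cast; ring
        rw [e1, Real.exp_add]
        have e2 := Real.add_one_le_exp (K * d * τ)
        calc 1 + d * (L + τ * (K * (1 + d * L))) = (K * d * τ + 1) * (1 + d * L) := by ring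
          _ ≤ Real.exp (K * d * τ) * ((1 + d * K) * Real.exp (K * d * (T - (k + 1 : ℕ) * τ))) := by
            gcongr
          _ = _ := by ring
      · have a1 := one w (z - w)
        have a2 := one z (w - z)
        rw [add_sub_cancel, gridPoint_sub] at a1 a2
        rw [norm_sub_rev] at a2
        exact abs_le.2 ⟨by linarith, by linarith⟩
  obtain ⟨L, hL, hexp, hlip⟩ := main
  refine (hlip z w).trans (mul_le_mul_of_nonneg_right ?_ (norm_nonneg _))
  have h1 : Real.exp (K * d * (T - k * τ)) ≤ Real.exp (K * d * T) := by
    apply Real.exp_le_exp.2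
    have : 0 ≤ (k : ℝ) * τ := by positivity
    gcongr; linarith
  calc L ≤ 1 + d * L := by nlinarith
    _ ≤ _ := hexp
    _ ≤ _ := by gcongr

end Lattice

/-! ### Doubling of variables: penalty, test inequalities, existence of a maximum. -/

/-- A bounded continuous viscosity subsolution attaining the terminal value `q`. -/
structure IsSubsolution {d : ℕ} (T : ℝ) (H : ℝ → Eucl d → Eucl d → ℝ) (q : Eucl d → ℝ)
    (v : ℝ → Eucl d → ℝ) : Prop where
  cont : ContinuousOn (fun z : ℝ × Eucl d => v z.1 z.2) (Icc (0 : ℝ) T ×ˢ univ)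
  bounded : ∃ B : ℝ, ∀ t ∈ Icc (0 : ℝ) T, ∀ x, |v t x| ≤ B
  terminal : ∀ x, v T x = q x
  sub : ∀ φ : ℝ × Eucl d → ℝ, ContDiff ℝ 1 φ → ∀ t ∈ Ioo (0 : ℝ) T, ∀ x,
    IsLocalMax (fun z : ℝ × Eucl d => v z.1 z.2 - φ z) (t, x) →
      0 ≤ deriv (fun s => φ (s, x)) t + H t x (∇ (fun y => φ (t, y)) x)

/-- The penalty used in the doubling of variables: `y`, `σ` are the doubled variables, the term in
`δ` localizes, the term in `l` makes the subsolution strict, and the exponential keeps the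
maximum away from the initial time. -/
noncomputable def penalty {d : ℕ} (T ε δ l P R : ℝ) (y : Eucl d) (σ t : ℝ) (x : Eucl d) : ℝ :=
  ‖x - y‖ ^ 2 / (2 * ε) + (t - σ) ^ 2 / (2 * ε) + δ * ‖x‖ ^ 2 + l * (T - t)
    + P * Real.exp (-(R * t))

section Doubling

variable {d : ℕ} {T : ℝ} {H : ℝ → Eucl d → Eucl d → ℝ} {q : Eucl d → ℝ} {v : ℝ → Eucl d → ℝ}

theorem hasGradientAt_penalty (T ε δ l P R : ℝ) (y : Eucl d) (σ t : ℝ) (x : Eucl d) :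
    HasGradientAt (fun x => penalty T ε δ l P R y σ t x)
      ((1 / ε) • (x - y) + (2 * δ) • x) x := by
  rw [hasGradientAt_iff_hasFDerivAt]
  have h1 : HasFDerivAt (fun x : Eucl d => ‖x - y‖ ^ 2) (2 • (innerSL ℝ (x - y))) x := by
    simpa using ((hasFDerivAt_id x).sub_const y).norm_sq
  have h2 : HasFDerivAt (fun x : Eucl d => ‖x‖ ^ 2) (2 • (innerSL ℝ x)) x := by
    simpa using (hasFDerivAt_id x).norm_sq
  have h3 := ((((h1.mul_const (1 / (2 * ε))).add_const ((t - σ) ^ 2 / (2 * ε))).add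
    (h2.const_mul δ)).add_const (l * (T - t))).add_const (P * Real.exp (-(R * t)))
  refine (h3.congr_fderiv ?_).congr_of_eventuallyEq ?_
  · ext w
    simp
    ring
  · refine Filter.Eventually.of_forall fun w => ?_
    simp only [penalty, Pi.add_apply]
    ring

theorem hasDerivAt_penalty (T ε δ l P R : ℝ) (y : Eucl d) (σ t : ℝ) (x : Eucl d) :
    HasDerivAt (fun t => penalty T ε δ l P R y σ t x)
      ((t - σ) / ε - l - R * (P * Real.exp (-(R * t)))) t := by
  have h1 : HasDerivAt (fun t : ℝ => (t - σ) ^ 2 / (2 * ε)) ((t - σ) / ε) t := by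
    have := (((hasDerivAt_id t).sub_const σ).pow 2).div_const (2 * ε)
    refine this.congr_deriv ?_
    simp only [id]
    by_cases h : ε = 0
    · simp [h]
    · field_simp; norm_num; ring
  have h2 : HasDerivAt (fun t : ℝ => l * (T - t)) (-l) t := by
    simpa using ((hasDerivAt_id t).const_sub T).const_mul l
  have h3 : HasDerivAt (fun t : ℝ => P * Real.exp (-(R * t)))
      (-(R * (P * Real.exp (-(R * t))))) t := by
    have := ((((hasDerivAt_id t).const_mul R).neg).exp).const_mul P
    refine this.congr_deriv ?_
    simp only [id, mul_one, Pi.neg_apply]; ring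
  have h4 := ((((h1.const_add (‖x - y‖ ^ 2 / (2 * ε))).add_const (δ * ‖x‖ ^ 2)).add h2).add h3)
  exact h4.congr_deriv (by ring)

theorem contDiff_penalty (T ε δ l P R : ℝ) (y : Eucl d) (σ : ℝ) :
    ContDiff ℝ 1 (fun z : ℝ × Eucl d => penalty T ε δ l P R y σ z.1 z.2) := by
  unfold penalty
  have h1 : ContDiff ℝ 1 (fun z : ℝ × Eucl d => ‖z.2 - y‖ ^ 2) :=
    (contDiff_snd.sub contDiff_const).norm_sq ℝ
  have h2 : ContDiff ℝ 1 (fun z : ℝ × Eucl d => ‖z.2‖ ^ 2) := contDiff_snd.norm_sq ℝ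
  fun_prop

/-- The subsolution inequality at a maximum point of `v - penalty`. -/
theorem IsSubsolution.penalized (hv : IsSubsolution T H q v) {ε δ l P R : ℝ} (hP : 0 ≤ P)
    (hR : 0 ≤ R) {y : Eucl d} {σ t : ℝ} (ht : t ∈ Ioo 0 T) {x : Eucl d}
    (hmax : ∀ s ∈ Icc 0 T, ∀ w, v s w - penalty T ε δ l P R y σ s w
      ≤ v t x - penalty T ε δ l P R y σ t x) :
    l ≤ (t - σ) / ε + H t x ((1 / ε) • (x - y) + (2 * δ) • x) := by
  have h1 := hv.sub _ (contDiff_penalty T ε δ l P R y σ) t ht x (by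
    have : Ioo 0 T ×ˢ univ ∈ nhds (t, x) :=
      prod_mem_nhds (Ioo_mem_nhds ht.1 ht.2) Filter.univ_mem
    filter_upwards [this] with z hz
    exact hmax z.1 (Ioo_subset_Icc_self hz.1) z.2)
  rw [(hasDerivAt_penalty T ε δ l P R y σ t x).deriv,
    (hasGradientAt_penalty T ε δ l P R y σ t x).gradient] at h1
  -- The time derivative of the exponential term has the favourable sign and is dropped.
  have : 0 ≤ R * (P * Real.exp (-(R * t))) := by positivity
  linarith

theorem norm_sub_gridPoint_add_single_sq (h : ℝ) (x : Eucl d) (z : Fin d → ℤ) (i : Fin d) :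
    ‖x - gridPoint h (z + Pi.single i 1)‖ ^ 2
      = ‖x - gridPoint h z‖ ^ 2 - 2 * h * (x - gridPoint h z) i + h ^ 2 := by
  rw [gridPoint_add, ← sub_sub, norm_sub_sq_real, gridPoint_single, real_inner_smul_right,
    EuclideanSpace.inner_single_right, norm_smul]
  simp
  ring

theorem norm_sub_gridPoint_sub_single_sq (h : ℝ) (x : Eucl d) (z : Fin d → ℤ) (i : Fin d) :
    ‖x - gridPoint h (z - Pi.single i 1)‖ ^ 2
      = ‖x - gridPoint h z‖ ^ 2 + 2 * h * (x - gridPoint h z) i + h ^ 2 := by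
  rw [gridPoint_sub, ← sub_add, norm_add_sq_real, gridPoint_single, real_inner_smul_right,
    EuclideanSpace.inner_single_right, norm_smul]
  simp
  ring

variable {n : ℕ} {τ h N K : ℝ} {U : ℕ → (Fin d → ℤ) → ℝ}

/-- The scheme inequality at a minimum point of the lattice solution plus a quadratic. -/
theorem IsLatticeSolution.penalized (hp : Parameters d n T τ h N)
    (hH : HamiltonianBounds T K N H) (hU : IsLatticeSolution n τ h N H q U) {ε κ t : ℝ}
    (hε : 0 < ε) {x : Eucl d} {k : ℕ} (hk : k < n) {z : Fin d → ℤ}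
    (hmin : ∀ w, U k z + (‖x - gridPoint h z‖ ^ 2 / (2 * ε) + (t - (k * τ + κ)) ^ 2 / (2 * ε))
      ≤ U (k + 1) w + (‖x - gridPoint h w‖ ^ 2 / (2 * ε)
        + (t - ((k + 1 : ℕ) * τ + κ)) ^ 2 / (2 * ε))) :
    (t - (k * τ + κ)) / ε + H ((k + 1 : ℕ) * τ) (gridPoint h z) ((1 / ε) • (x - gridPoint h z))
      ≤ (N * d * h + τ / 2) / ε := by
  have hh := hp.h_pos
  have hτ := hp.τ_pos
  set g : (Fin d → ℤ) → ℝ := fun w => -(‖x - gridPoint h w‖ ^ 2 / (2 * ε)) with hg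
  set b : ℝ := U k z + (‖x - gridPoint h z‖ ^ 2 / (2 * ε) + (t - (k * τ + κ)) ^ 2 / (2 * ε))
    - (t - ((k + 1 : ℕ) * τ + κ)) ^ 2 / (2 * ε) with hb
  -- The concave quadratic `g + b` lies below `U (k + 1)`, so its step at `z` is at most `U k z`.
  -- Central differences are exact on quadratics: only the viscosity `N d h / ε` and the time error
  -- `τ / (2 ε)` remain.
  have h1 := step_mono hp hH (hp.mem_Icc (Nat.succ_le_of_lt hk)) (g := fun w => g w + b)
    (g' := U (k + 1)) (fun w => by have := hmin w; simp only [hg, hb]; linarith) z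
  have hgrad : latGrad h g z = (1 / ε) • (x - gridPoint h z) := by
    ext i
    simp only [latGrad, hg, norm_sub_gridPoint_add_single_sq, norm_sub_gridPoint_sub_single_sq,
      PiLp.smul_apply, smul_eq_mul]
    field_simp
    ring
  have hlap : latLap h g z = -(d / ε) := by
    have : ∀ i : Fin d, (g (z + Pi.single i 1) - 2 * g z + g (z - Pi.single i 1)) / h ^ 2
        = -(1 / ε) := by
      intro i
      simp only [hg, norm_sub_gridPoint_add_single_sq, norm_sub_gridPoint_sub_single_sq]
      field_simp
      ring
    simp only [latLap, this]
    simp [div_eq_mul_inv]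
  rw [step_add_const, ← hU.eqn k hk z, step, hgrad, hlap] at h1
  set Hv := H ((k + 1 : ℕ) * τ) (gridPoint h z) ((1 / ε) • (x - gridPoint h z))
  have h2 : g z + b - U k z = τ * ((t - (k * τ + κ)) / ε - τ / 2 / ε) := by
    simp only [hg, hb]; push_cast; field_simp; ring
  have h3 : τ * ((t - (k * τ + κ)) / ε - τ / 2 / ε + (Hv + N * h * -(d / ε))) ≤ τ * 0 := by
    rw [mul_add, ← h2]; linarith
  have h4 := le_of_mul_le_mul_left h3 hτ
  have h5 : (N * d * h + τ / 2) / ε = τ / 2 / ε - N * h * -(d / ε) := by ring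
  linarith

/-- The term in `δ` confines `x`, the term in `ε` then confines the grid point, and the lattice is
discrete, so the maximum over a compact box exists. Outside the box the penalty is so large that the
value is below that at the reference point `(T, 0, 0, 0)`. -/
theorem IsSubsolution.exists_max (hv : IsSubsolution T H q v) (hT : 0 ≤ T) (hh : 0 < h) {B : ℝ}
    (hvB : ∀ t ∈ Icc 0 T, ∀ x, |v t x| ≤ B) (hUB : ∀ k ≤ n, ∀ z, |U k z| ≤ B)
    {ε δ l P : ℝ} (R τ κ : ℝ) (hε : 0 < ε) (hδ : 0 < δ) (hl : 0 ≤ l) (hP : 0 ≤ P) :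
    ∃ t ∈ Icc 0 T, ∃ x, ∃ k ≤ n, ∃ z, ∀ t' ∈ Icc 0 T, ∀ x', ∀ k' ≤ n, ∀ z',
      v t' x' - U k' z' - penalty T ε δ l P R (gridPoint h z') (k' * τ + κ) t' x'
        ≤ v t x - U k z - penalty T ε δ l P R (gridPoint h z) (k * τ + κ) t x := by
  let Φ : ℝ × Eucl d × ℕ × (Fin d → ℤ) → ℝ := fun p => v p.1 p.2.1 - U p.2.2.1 p.2.2.2
    - penalty T ε δ l P R (gridPoint h p.2.2.2) (p.2.2.1 * τ + κ) p.1 p.2.1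
  have hpen : ∀ y σ, ∀ t ∈ Icc 0 T, ∀ x : Eucl d, ‖x - y‖ ^ 2 / (2 * ε) + δ * ‖x‖ ^ 2
      ≤ penalty T ε δ l P R y σ t x := by
    intro y σ t ht x
    have h1 : 0 ≤ (t - σ) ^ 2 / (2 * ε) := by positivity
    have h2 : 0 ≤ l * (T - t) := mul_nonneg hl (sub_nonneg.2 ht.2)
    have h3 : 0 ≤ P * Real.exp (-(R * t)) := by positivity
    simp only [penalty]; linarith
  set Q := penalty T ε δ l P R (gridPoint h (0 : Fin d → ℤ)) ((0 : ℕ) * τ + κ) T 0 with hQ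
  have hTm : T ∈ Icc 0 T := ⟨hT, le_rfl⟩
  have hQ0 : 0 ≤ Q := le_trans (by positivity) (hpen _ _ T hTm _)
  have hB0 : 0 ≤ B := (abs_nonneg _).trans (hvB T hTm 0)
  -- Since `v - U ≤ 2B`, a penalty of at least `A` pushes the value below `-2B - Q`, a lower bound
  -- at the reference point. The radii `ρ` and `ρ'` below force such a penalty.
  set A := 4 * B + Q with hA
  have hA0 : 0 ≤ A := by positivity
  set ρ := A / δ + 1 with hρ
  have hρ1 : 1 ≤ ρ := by have : 0 ≤ A / δ := by positivity
                         linarith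
  set ρ' := (ρ + 2 * ε * A + 1) / h with hρ'
  have hρ'0 : 0 ≤ ρ' := by positivity
  let S : Set (ℝ × Eucl d × ℕ × (Fin d → ℤ)) :=
    Icc 0 T ×ˢ Metric.closedBall 0 ρ ×ˢ Iic n ×ˢ Metric.closedBall 0 ρ'
  have hS : IsCompact S := isCompact_Icc.prod ((isCompact_closedBall _ _).prod
    ((finite_Iic n).isCompact.prod (isCompact_closedBall _ _)))
  have hcont : ContinuousOn Φ S := by
    have h1 : ContinuousOn (fun p : ℝ × Eucl d × ℕ × (Fin d → ℤ) => v p.1 p.2.1) S := by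
      refine hv.cont.comp (f := fun p : ℝ × Eucl d × ℕ × (Fin d → ℤ) => (p.1, p.2.1))
        (by fun_prop) fun p hp => ⟨hp.1, mem_univ _⟩
    have h2 : Continuous (fun p : ℝ × Eucl d × ℕ × (Fin d → ℤ) => U p.2.2.1 p.2.2.2) :=
      (continuous_of_discreteTopology (f := fun p : ℕ × (Fin d → ℤ) => U p.1 p.2)).comp
        (continuous_snd.comp continuous_snd)
    have h3 : Continuous (fun p : ℝ × Eucl d × ℕ × (Fin d → ℤ) =>
        (gridPoint h p.2.2.2 : Eucl d)) :=
      (continuous_of_discreteTopology (f := fun z : Fin d → ℤ => (gridPoint h z : Eucl d))).comp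
        (continuous_snd.comp (continuous_snd.comp continuous_snd))
    have h4 : Continuous (fun p : ℝ × Eucl d × ℕ × (Fin d → ℤ) => (p.2.2.1 : ℝ)) :=
      (continuous_of_discreteTopology (f := fun k : ℕ => (k : ℝ))).comp
        (continuous_fst.comp (continuous_snd.comp continuous_snd))
    refine (h1.sub h2.continuousOn).sub (Continuous.continuousOn ?_)
    unfold penalty
    fun_prop
  have href : ((T, 0, 0, 0) : ℝ × Eucl d × ℕ × (Fin d → ℤ)) ∈ S :=
    ⟨hTm, Metric.mem_closedBall_self (by linarith), Nat.zero_le n,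
      Metric.mem_closedBall_self hρ'0⟩
  obtain ⟨⟨t, x, k, z⟩, ⟨ht, hx, hk, hz⟩, hmax⟩ := hS.exists_isMaxOn ⟨_, href⟩ hcont
  refine ⟨t, ht, x, k, hk, z, fun t' ht' x' k' hk' z' => ?_⟩
  by_cases hmem : ((t', x', k', z') : ℝ × Eucl d × ℕ × (Fin d → ℤ)) ∈ S
  · exact hmax hmem
  refine le_trans ?_ (hmax href)
  have hlow : -(2 * B) - Q ≤ Φ (T, 0, 0, 0) := by
    have h1 := (abs_le.1 (hvB T hTm 0)).1
    have h2 := (abs_le.1 (hUB 0 (Nat.zero_le n) 0)).2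
    simp only [Φ, ← hQ]
    linarith
  refine le_trans ?_ hlow
  have h1 := (abs_le.1 (hvB t' ht' x')).2
  have h2 := (abs_le.1 (hUB k' hk' z')).1
  have h3 := hpen (gridPoint h z') (k' * τ + κ) t' ht' x'
  suffices A ≤ ‖x' - gridPoint h z'‖ ^ 2 / (2 * ε) + δ * ‖x'‖ ^ 2 by linarith
  by_cases hx' : ‖x'‖ ≤ ρ
  · have hz' : ρ' < ‖z'‖ := by
      by_contra hcon
      exact hmem ⟨ht', by simpa using hx', hk', by simpa using hcon⟩
    obtain ⟨i, hi⟩ : ∃ i, ρ' < ‖z' i‖ := by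
      by_contra! hcon
      exact absurd ((pi_norm_le_iff_of_nonneg hρ'0).2 hcon) (not_le.2 hz')
    have h4 : h * ρ' ≤ ‖gridPoint h z'‖ := by
      refine le_trans ?_ (PiLp.norm_apply_le _ i)
      simp only [gridPoint, norm_mul, Real.norm_eq_abs, abs_of_pos hh]
      rw [Int.norm_eq_abs] at hi
      gcongr
    have h5 : h * ρ' = ρ + 2 * ε * A + 1 := by rw [hρ']; field_simp
    have h6 : 2 * ε * A + 1 ≤ ‖x' - gridPoint h z'‖ := by
      have := norm_sub_norm_le (gridPoint h z') x'
      rw [norm_sub_rev] at this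
      linarith
    have h7 : A ≤ ‖x' - gridPoint h z'‖ ^ 2 / (2 * ε) := by
      rw [le_div_iff₀ (by positivity)]
      have : 0 ≤ 2 * ε * A := by positivity
      nlinarith
    have : 0 ≤ δ * ‖x'‖ ^ 2 := by positivity
    linarith
  · have h4 : δ * ρ = A + δ := by rw [hρ]; field_simp
    have h5 : ρ ≤ ‖x'‖ ^ 2 := by nlinarith
    have h6 : δ * ρ ≤ δ * ‖x'‖ ^ 2 := by gcongr
    have : 0 ≤ ‖x' - gridPoint h z'‖ ^ 2 / (2 * ε) := by positivity
    linarith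

end Doubling

/-! ### The one-sided error bound. -/

section ErrorBound

variable {d n : ℕ} {T τ h N K : ℝ} {H : ℝ → Eucl d → Eucl d → ℝ} {q : Eucl d → ℝ}
  {v : ℝ → Eucl d → ℝ} {U : ℕ → (Fin d → ℤ) → ℝ}

/-- The doubled function has a maximum point off the initial time, at which the localization is
negligible, and its maximum almost bounds `v - U`. -/
theorem IsSubsolution.exists_penalized_max (hv : IsSubsolution T H q v) (hh : 0 < h)
    {B : ℝ} (hvB : ∀ t ∈ Icc 0 T, ∀ x, |v t x| ≤ B) (hUB : ∀ k ≤ n, ∀ z, |U k z| ≤ B)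
    {ε l κ s η δ₀ : ℝ} (hε : 0 < ε) (hl : 0 ≤ l) (hs : 0 < s) (hη : 0 < η) (hδ₀ : 0 < δ₀)
    {t₁ : ℝ} (ht₁ : t₁ ∈ Ioc 0 T) {k₁ : ℕ} (hk₁ : k₁ ≤ n) (z₁ : Fin d → ℤ) :
    ∃ δ P R : ℝ, 0 < δ ∧ δ ≤ δ₀ ∧ 0 ≤ P ∧ 0 ≤ R ∧
    ∃ t ∈ Ioc 0 T, ∃ x, ∃ k ≤ n, ∃ z, δ * ‖x‖ ≤ s ∧
      (∀ t' ∈ Icc 0 T, ∀ x', ∀ k' ≤ n, ∀ z',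
        v t' x' - U k' z' - penalty T ε δ l P R (gridPoint h z') (k' * τ + κ) t' x'
          ≤ v t x - U k z - penalty T ε δ l P R (gridPoint h z) (k * τ + κ) t x) ∧
      v t₁ (gridPoint h z₁) - U k₁ z₁ - (t₁ - (k₁ * τ + κ)) ^ 2 / (2 * ε) - l * (T - t₁) - 2 * η
        ≤ v t x - U k z - penalty T ε δ l P R (gridPoint h z) (k * τ + κ) t x := by
  have ht₁' : t₁ ∈ Icc 0 T := Ioc_subset_Icc_self ht₁
  have hT : 0 ≤ T := ht₁.1.le.trans ht₁.2
  have hB0 : 0 ≤ B := (abs_nonneg _).trans (hvB t₁ ht₁' 0)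
  set Y : Eucl d := gridPoint h z₁ with hY
  set η' := min η 1 with hη'
  have hη'0 : 0 < η' := lt_min hη one_pos
  set Q := (t₁ - (k₁ * τ + κ)) ^ 2 / (2 * ε) + l * T + 2 with hQ
  have hQ0 : 0 ≤ Q := by positivity
  -- Comparison with the point `(t₁, Y, k₁, z₁)` bounds the penalty at the maximum by `4B + Q`. As
  -- `P` exceeds this, the maximum is not at `t = 0`, while `R` makes the exponential term at `t₁`
  -- at most `η'`.
  set P := 4 * B + Q + 1 with hP
  have hP0 : 0 ≤ P := by positivity
  set R := P / (η' * t₁) with hR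
  have ht₁0 := ht₁.1
  have hR0 : 0 ≤ R := by positivity
  have hexp : P * Real.exp (-(R * t₁)) ≤ η' := by
    have h1 : R * t₁ = P / η' := by rw [hR]; field_simp
    have h2 := Real.add_one_le_exp (P / η')
    rw [h1, Real.exp_neg, ← div_eq_mul_inv, div_le_iff₀ (Real.exp_pos _)]
    calc P = η' * (P / η') := by field_simp
      _ ≤ η' * Real.exp (P / η') := by gcongr; linarith
  -- The second entry makes the localization at `Y` negligible. The third gives `(δ‖x‖)² = δ · δ‖x‖²
  -- ≤ δ (4B + Q) ≤ s²` at the maximum.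
  set δ := min δ₀ (min (η' / (‖Y‖ ^ 2 + 1)) (s ^ 2 / (4 * B + Q + 1))) with hδ
  have hδ0 : 0 < δ := lt_min hδ₀ (lt_min (by positivity) (by positivity))
  have hδ1 : δ * ‖Y‖ ^ 2 ≤ η' := by
    have h1 : δ ≤ η' / (‖Y‖ ^ 2 + 1) := (min_le_right _ _).trans (min_le_left _ _)
    rw [le_div_iff₀ (by positivity)] at h1
    linarith
  have hδ2 : δ * (4 * B + Q) ≤ s ^ 2 := by
    have h1 : δ ≤ s ^ 2 / (4 * B + Q + 1) := (min_le_right _ _).trans (min_le_right _ _)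
    rw [le_div_iff₀ (by positivity)] at h1
    linarith
  obtain ⟨t, ht, x, k, hk, z, hmax⟩ := hv.exists_max hT hh hvB hUB R τ κ hε hδ0 hl hP0
  have hη1 : η' ≤ η := min_le_left _ _
  have hη2 : η' ≤ 1 := min_le_right _ _
  have hat := hmax t₁ ht₁' Y k₁ hk₁ z₁
  have hpen₁ : penalty T ε δ l P R Y (k₁ * τ + κ) t₁ Y
      ≤ (t₁ - (k₁ * τ + κ)) ^ 2 / (2 * ε) + l * (T - t₁) + 2 * η' := by
    simp only [penalty, sub_self, norm_zero]
    norm_num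
    linarith
  have hlt : 0 ≤ l * t₁ := by positivity
  have hv₁ := (abs_le.1 (hvB t₁ ht₁' Y)).1
  have hU₁ := (abs_le.1 (hUB k₁ hk₁ z₁)).2
  have hvt := (abs_le.1 (hvB t ht x)).2
  have hUk := (abs_le.1 (hUB k hk z)).1
  have p1 : 0 ≤ ‖x - gridPoint h z‖ ^ 2 / (2 * ε) := by positivity
  have p2 : 0 ≤ (t - (k * τ + κ)) ^ 2 / (2 * ε) := by positivity
  have p3 : 0 ≤ δ * ‖x‖ ^ 2 := by positivity
  have p4 : 0 ≤ l * (T - t) := mul_nonneg hl (sub_nonneg.2 ht.2)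
  have p5 : 0 ≤ P * Real.exp (-(R * t)) := by positivity
  have hval : penalty T ε δ l P R (gridPoint h z) (k * τ + κ) t x ≤ 4 * B + Q := by linarith
  refine ⟨δ, P, R, hδ0, min_le_left _ _, hP0, hR0, t, ⟨lt_of_le_of_ne ht.1 ?_, ht.2⟩, x, k, hk, z,
    ?_, hmax, by linarith⟩
  · rintro rfl
    simp only [penalty, mul_zero, neg_zero, Real.exp_zero, mul_one] at hval p4
    linarith
  · simp only [penalty] at hval
    refine abs_le_of_sq_le_sq' ?_ hs.le |>.2
    calc (δ * ‖x‖) ^ 2 = δ * (δ * ‖x‖ ^ 2) := by ring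
      _ ≤ δ * (4 * B + Q) := by gcongr; linarith
      _ ≤ s ^ 2 := hδ2

/-- At a maximum point of the doubled function the spatial variables are close, provided that one
of the two functions is Lipschitz continuous in space. -/
theorem norm_sub_le_of_max {ε δ l P R κ L r t : ℝ} (hε : 0 < ε) (hL : 0 ≤ L)
    (hr : ε * (1 + L) = r) (hh : 0 < h) (hhr : h ≤ r) (hδ0 : 0 < δ) (hδ : δ ≤ 1 / (4 * ε))
    {x : Eucl d} {k : ℕ} {z : Fin d → ℤ} (hx : 2 * (δ * ‖x‖) ≤ 1)
    (hlip : (∀ x y, |v t x - v t y| ≤ L * ‖x - y‖) ∨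
      (∀ z w, |U k z - U k w| ≤ L * ‖gridPoint h z - gridPoint h w‖))
    (hmax : ∀ x' z',
        v t x' - U k z' - penalty T ε δ l P R (gridPoint h z') (k * τ + κ) t x'
          ≤ v t x - U k z - penalty T ε δ l P R (gridPoint h z) (k * τ + κ) t x) :
    ‖x - gridPoint h z‖ ≤ (d + 4) * r := by
  set y : Eucl d := gridPoint h z with hy
  set ρ := ‖x - y‖ with hρ
  have hρ0 : 0 ≤ ρ := norm_nonneg _
  have hr0 : 0 < r := by rw [← hr]; positivity
  have hd0 : (0 : ℝ) ≤ d := d.cast_nonneg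
  rcases hlip with hlip | hlip
  -- If `v` is Lipschitz, compare with moving `x` to the grid point `y`.
  · have h1 := hmax y z
    have h2 := (abs_le.1 (hlip x y)).2
    have h3 : ‖y‖ ≤ ‖x‖ + ρ := by
      have := norm_sub_le x (x - y)
      rwa [sub_sub_cancel] at this
    have h4 : δ * ‖y‖ ^ 2 ≤ δ * (‖x‖ + ρ) ^ 2 := by gcongr
    simp only [penalty, ← hy, sub_self, norm_zero, ← hρ] at h1
    have h5 : δ * ρ ^ 2 ≤ 1 / (4 * ε) * ρ ^ 2 := by gcongr
    have h6 : ρ ^ 2 / (2 * ε) = 2 * (1 / (4 * ε) * ρ ^ 2) := by field_simp; norm_num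
    have h7 : 2 * (δ * ‖x‖) * ρ ≤ 1 * ρ := by gcongr
    have h8 : 1 / (4 * ε) * ρ ^ 2 ≤ (1 + L) * ρ := by
      norm_num at h1
      nlinarith
    have h9 : ρ ^ 2 ≤ 4 * r * ρ := by
      rw [← hr]
      calc ρ ^ 2 = 4 * ε * (1 / (4 * ε) * ρ ^ 2) := by field_simp
        _ ≤ 4 * ε * ((1 + L) * ρ) := by gcongr
        _ = _ := by ring
    have h10 : ρ ≤ 4 * r := by
      by_contra! hcon
      nlinarith
    nlinarith
  -- If `U` is Lipschitz, move the grid point to one near `x`. The rounding distance `d h ≤ d r`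
  -- does not spoil the order.
  · obtain ⟨z', hz'⟩ := exists_gridPoint_near hh x
    have h1 := hmax x z'
    have h2 := (abs_le.1 (hlip z' z)).2
    have h3 : ‖gridPoint h z' - y‖ ≤ ρ + d * r := by
      have := norm_sub_le_norm_sub_add_norm_sub (gridPoint h z') x y
      rw [norm_sub_rev (gridPoint h z') x] at this
      have : d * h ≤ d * r := by gcongr
      linarith
    have h4 : ‖x - gridPoint h z'‖ ^ 2 ≤ (d * r) ^ 2 := by
      have : ‖x - gridPoint h z'‖ ≤ d * r := hz'.trans (by gcongr)
      gcongr
    have h5 : L * ‖gridPoint h z' - y‖ ≤ L * (ρ + d * r) := by gcongr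
    simp only [penalty, ← hρ] at h1
    have h6 : ρ ^ 2 / (2 * ε) ≤ (d * r) ^ 2 / (2 * ε) + L * (ρ + d * r) := by
      have : ‖x - gridPoint h z'‖ ^ 2 / (2 * ε) ≤ (d * r) ^ 2 / (2 * ε) := by gcongr
      linarith
    have h7 : ρ ^ 2 ≤ (d * r) ^ 2 + 2 * (ε * L) * (ρ + d * r) := by
      calc ρ ^ 2 = 2 * ε * (ρ ^ 2 / (2 * ε)) := by field_simp
        _ ≤ 2 * ε * ((d * r) ^ 2 / (2 * ε) + L * (ρ + d * r)) := by gcongr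
        _ = _ := by field_simp
    have h8 : ε * L ≤ r := by linarith
    have h9 : 2 * (ε * L) * (ρ + d * r) ≤ 2 * r * (ρ + d * r) := by gcongr
    have h10 : (ρ - r) ^ 2 ≤ ((d + 1) * r) ^ 2 := by linarith
    have h11 := (abs_le_of_sq_le_sq' h10 (by positivity)).2
    linarith

/-- The constant in the error bound for the doubling of variables. -/
noncomputable def errorConst (d : ℕ) (N K : ℝ) : ℝ :=
  K * (d + 4) + (K * (1 + d * K) + 2 * d * N * K) * (N * d + 1 + K * (d + 5) + K * (d + 6))
    + (K * (d + 6)) ^ 2 / 2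
    + (K * (d + 5) * (2 * (K * (d + 6)) + (N * d + 1) + d + 5) + (N * d + 1) + 1)

theorem errorConst_pos (d : ℕ) {N K : ℝ} (hN : 0 ≤ N) (hK : 0 ≤ K) : 0 < errorConst d N K := by
  unfold errorConst; positivity

set_option maxHeartbeats 800000 in
/-- The maximum of the doubled function is attained at the terminal time and is of order `√h`. -/
theorem IsSubsolution.le_of_penalized_max (hp : Parameters d n T τ h N)
    (hH : HamiltonianBounds T K N H) (hK : 0 ≤ K) (hq : ∀ x y, |q x - q y| ≤ K * ‖x - y‖)
    (hv : IsSubsolution T H q v) (hU : IsLatticeSolution n τ h N H q U)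
    {ε δ l P R κ L r s t c₁ c₂ : ℝ} (hc₁ : c₁ = K * (d + 6)) (hc₂ : c₂ = N * d + 1)
    (hr0 : 0 < r) (hr2 : r ^ 2 = h) (hε : 0 < ε) (hL : 0 ≤ L) (hr : ε * (1 + L) = r)
    (hκ : κ = c₁ * r)
    (hl : l = (K * (d + 5) * (2 * c₁ + c₂ + d + 5) + c₂ + 1) * (1 + L) * r)
    (hs : s = min (1 / 2) ((1 + L) * r / (8 * N * d)))
    (hδ0 : 0 < δ) (hδ : δ ≤ 1 / (4 * ε)) (hP : 0 ≤ P) (hR : 0 ≤ R)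
    (ht : t ∈ Ioc 0 T) {x : Eucl d} {k : ℕ} (hk : k ≤ n) {z : Fin d → ℤ} (hx : δ * ‖x‖ ≤ s)
    (hlip : (∀ t ∈ Icc 0 T, ∀ x y, |v t x - v t y| ≤ L * ‖x - y‖) ∨
      (∀ k ≤ n, ∀ z w, |U k z - U k w| ≤ L * ‖gridPoint h z - gridPoint h w‖))
    (hmax : ∀ t' ∈ Icc 0 T, ∀ x', ∀ k' ≤ n, ∀ z',
        v t' x' - U k' z' - penalty T ε δ l P R (gridPoint h z') (k' * τ + κ) t' x'
          ≤ v t x - U k z - penalty T ε δ l P R (gridPoint h z) (k * τ + κ) t x) :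
    v t x - U k z - penalty T ε δ l P R (gridPoint h z) (k * τ + κ) t x
      ≤ (K * (d + 4) + (K * (1 + d * K) + 2 * d * N * K) * (c₂ + K * (d + 5) + c₁)) * r := by
  have hd : (1 : ℝ) ≤ d := by exact_mod_cast hp.one_le_d
  have hN := hp.one_le_N
  have hN0 : 0 < N := by linarith
  have hτ := hp.τ_pos
  have ht' : t ∈ Icc 0 T := Ioc_subset_Icc_self ht
  have hr1 : r ≤ 1 := by nlinarith [hp.h_le]
  have hhr : h ≤ r := by nlinarith
  have hτr : τ ≤ r := hp.τ_le.trans hhr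
  have hs1 : s ≤ 1 / 2 := hs ▸ min_le_left _ _
  have hs2 : 4 * N * d * s ≤ (1 + L) * r / 2 := by
    have : s ≤ (1 + L) * r / (8 * N * d) := hs ▸ min_le_right _ _
    rw [le_div_iff₀ (by positivity)] at this
    linarith
  have hc₁0 : 0 ≤ c₁ := by rw [hc₁]; positivity
  have hc₂0 : 0 < c₂ := by rw [hc₂]; positivity
  have hl0 : 0 < l := by rw [hl]; positivity
  have hdist : ‖x - gridPoint h z‖ ≤ (d + 4) * r :=
    norm_sub_le_of_max hε hL hr hp.h_pos hhr hδ0 hδ (by linarith)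
      (hlip.imp (fun H => H t ht') (fun H => H k hk)) (fun x' z' => hmax t ht' x' k hk z')
  obtain ⟨y, hy⟩ : ∃ y : Eucl d, y = gridPoint h z := ⟨_, rfl⟩
  obtain ⟨p, hpdef⟩ : ∃ p : Eucl d, p = (1 / ε) • (x - y) := ⟨_, rfl⟩
  rw [← hy] at hdist hmax ⊢
  have hpn : ‖p‖ ≤ (d + 4) * (1 + L) := by
    rw [hpdef, norm_smul, Real.norm_of_nonneg (by positivity), one_div, inv_mul_le_iff₀ hε]
    calc _ ≤ _ := hdist
      _ = _ := by rw [← hr]; ring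
  have hKp : K * (1 + ‖p‖) ≤ K * (d + 5) * (1 + L) := by
    rw [mul_assoc]; gcongr; nlinarith
  obtain ⟨a, ha⟩ : ∃ a, a = (t - (k * τ + κ)) / ε := ⟨_, rfl⟩
  have haε : t - (k * τ + κ) = a * ε := by rw [ha]; field_simp
  have hdisc : k < n → a + H ((k + 1 : ℕ) * τ) y p ≤ c₂ * (1 + L) * r := by
    intro hkn
    have h1 := hU.penalized hp hH (ε := ε) (κ := κ) (t := t) hε hkn (x := x) (z := z) (fun w => by
      have := hmax t ht' x (k + 1) hkn w
      simp only [penalty, hy] at this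
      linarith)
    rw [← hy, ← ha, ← hpdef] at h1
    refine h1.trans ?_
    rw [div_le_iff₀ hε]
    have h2 : c₂ * (1 + L) * r * ε = c₂ * h := by rw [← hr2, ← hr]; ring
    rw [h2, hc₂]
    linarith [hp.τ_le]
  have hdisc' : k < n → a + H ((k + 1 : ℕ) * τ) y p ≤ c₂ * (1 + L) := fun hkn =>
    (hdisc hkn).trans (mul_le_of_le_one_right (by positivity) hr1)
  rcases ht.2.lt_or_eq with htT | htT
  -- A maximum with `t < T` contradicts the choice of `l`.
  · exfalso
    have hsub := hv.penalized hP hR ⟨ht.1, htT⟩ (x := x) (fun s hs w => by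
      have := hmax s hs w k hk z
      rw [← hy] at this
      linarith)
    rw [← ha, ← hpdef] at hsub
    obtain ⟨p', hp'⟩ : ∃ p' : Eucl d, p' = p + (2 * δ) • x := ⟨_, rfl⟩
    rw [← hp'] at hsub
    have hp'n : ‖p'‖ ≤ ‖p‖ + 1 := by
      rw [hp']
      refine (norm_add_le _ _).trans ?_
      rw [norm_smul, Real.norm_of_nonneg (r := 2 * δ) (by positivity)]
      linarith
    have hH1 := (abs_le.1 (hH.bound t ht' x p')).2
    have hKp' : K * (1 + ‖p'‖) ≤ c₁ * (1 + L) := by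
      rw [hc₁, mul_assoc]; gcongr; nlinarith
    -- If `k = n`, then `t - T - κ < -κ` makes `a < -c₁ (1 + L)`, which outweighs the Hamiltonian in
    -- the subsolution inequality. This is the purpose of `κ`.
    have hkn : k < n := by
      refine lt_of_le_of_ne hk ?_
      rintro rfl
      rw [← hp.T_eq] at haε
      have h1 : (a + c₁ * (1 + L)) * ε < 0 := by
        have : c₁ * (1 + L) * ε = κ := by rw [hκ, ← hr]; ring
        rw [add_mul, this]; linarith
      have h2 : a + c₁ * (1 + L) < 0 := by
        by_contra hcon
        exact absurd h1 (not_lt.2 (mul_nonneg (not_lt.1 hcon) hε.le))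
      linarith
    have hdk := hdisc' hkn
    have htk := hp.mem_Icc (Nat.succ_le_of_lt hkn)
    have hH2 := (abs_le.1 (hH.bound _ htk y p)).1
    have hd5 : K * (d + 5) ≤ c₁ := by rw [hc₁]; gcongr; norm_num
    have hd5' : K * (d + 5) * (1 + L) ≤ c₁ * (1 + L) := by gcongr
    -- The subsolution inequality bounds `a` from below and the scheme from above, so the two times
    -- are within `O(r)`.
    have haabs : |a| ≤ (c₁ + c₂) * (1 + L) := by
      have : 0 ≤ c₂ * (1 + L) := by positivity
      have : 0 ≤ c₁ * (1 + L) := by positivity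
      rw [add_mul]
      exact abs_le.2 ⟨by linarith, by linarith⟩
    have htime : |t - (k + 1 : ℕ) * τ| ≤ (2 * c₁ + c₂ + 1) * r := by
      have h1 : t - (k + 1 : ℕ) * τ = a * ε + (κ - τ) := by rw [← haε]; push_cast; ring
      have h2 : |a * ε| ≤ (c₁ + c₂) * r := by
        rw [abs_mul, abs_of_pos hε, ← hr]
        calc |a| * ε ≤ (c₁ + c₂) * (1 + L) * ε := by gcongr
          _ = _ := by ring
      have h3 : |κ - τ| ≤ c₁ * r + r := by
        have : 0 ≤ κ := by rw [hκ]; positivity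
        exact abs_le.2 ⟨by linarith, by linarith⟩
      rw [h1]
      refine (abs_add_le _ _).trans ?_
      linarith
    have hmom : H t x p' - H t x p ≤ (1 + L) * r / 2 := by
      have h1 := (abs_le.1 (hH.lip_momentum t ht' x p' p)).2
      have h2 : ∑ i, |p' i - p i| ≤ d * (2 * s) := by
        calc ∑ i, |p' i - p i| ≤ ∑ _i : Fin d, 2 * s := by
              refine Finset.sum_le_sum fun i _ => ?_
              have : p' i - p i = 2 * δ * x i := by simp [hp']
              rw [this, abs_mul, abs_of_pos (by positivity)]
              have h3 : |x i| ≤ ‖x‖ := PiLp.norm_apply_le x i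
              calc 2 * δ * |x i| ≤ 2 * δ * ‖x‖ := by gcongr
                _ ≤ 2 * s := by linarith
          _ = d * (2 * s) := by simp
      calc _ ≤ _ := h1
        _ ≤ 2 * N * (d * (2 * s)) := by gcongr
        _ ≤ _ := by linarith
    have hspace : H t x p - H ((k + 1 : ℕ) * τ) y p
        ≤ K * (d + 5) * (2 * c₁ + c₂ + d + 5) * (1 + L) * r := by
      have h1 := (abs_le.1 (hH.lip t ht' _ htk x y p)).2
      calc _ ≤ _ := h1
        _ ≤ K * (d + 5) * (1 + L) * ((2 * c₁ + c₂ + 1) * r + (d + 4) * r) := by gcongr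
        _ = _ := by ring
    -- Adding the two inequalities bounds `l` by the momentum, space-time and discretization errors;
    -- their sum is less than `l`, the momentum error being at most half of the spare `(1 + L) r`.
    have hdk' := hdisc hkn
    have : 0 < (1 + L) * r := by positivity
    rw [hl] at hsub
    linarith
  · subst htT
    have p1 : 0 ≤ ‖x - y‖ ^ 2 / (2 * ε) := by positivity
    have p2 : 0 ≤ (t - (k * τ + κ)) ^ 2 / (2 * ε) := by positivity
    have p3 : 0 ≤ δ * ‖x‖ ^ 2 := by positivity
    have p5 : 0 ≤ P * Real.exp (-(R * t)) := by positivity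
    have hspeed : 0 ≤ K * (1 + d * K) + 2 * d * N * K := by positivity
    have h1 := (abs_le.1 (hU.abs_sub_terminal_le hp hH hK hq hk z)).1
    rw [← hy] at h1
    have h2 := (abs_le.1 (hq x y)).2
    have h3 : K * ‖x - y‖ ≤ K * ((d + 4) * r) := by gcongr
    -- The terminal time is reached by `v` but perhaps not by the scheme; the scheme inequality
    -- limits the gap to `O(r)`.
    have h4 : t - k * τ ≤ (c₂ + K * (d + 5) + c₁) * r := by
      rcases hk.lt_or_eq with hkn | hkn
      · have h5 := hdisc' hkn
        have h6 := (abs_le.1 (hH.bound _ (hp.mem_Icc (Nat.succ_le_of_lt hkn)) y p)).1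
        have h7 : a ≤ (c₂ + K * (d + 5)) * (1 + L) := by linarith
        have h8 : a * ε ≤ (c₂ + K * (d + 5)) * r := by
          rw [← hr]
          calc a * ε ≤ (c₂ + K * (d + 5)) * (1 + L) * ε := by gcongr
            _ = _ := by ring
        rw [← haε] at h8
        linarith
      · rw [hkn, ← hp.T_eq, sub_self]; positivity
    have h5 := mul_le_mul_of_nonneg_left h4 hspeed
    rw [hv.terminal]
    simp only [penalty, sub_self, mul_zero]
    linarith

/-- One-sided error bound: a subsolution exceeds the lattice solution by at most
`C (1 + T) (1 + L) √h`, where `L` is a spatial Lipschitz constant of either of them. -/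
theorem IsSubsolution.sub_le (hp : Parameters d n T τ h N) (hT : 0 < T)
    (hH : HamiltonianBounds T K N H) (hK : 0 ≤ K) (hq : ∀ x y, |q x - q y| ≤ K * ‖x - y‖)
    (hv : IsSubsolution T H q v) (hU : IsLatticeSolution n τ h N H q U) {L : ℝ} (hL : 0 ≤ L)
    (hlip : (∀ t ∈ Icc 0 T, ∀ x y, |v t x - v t y| ≤ L * ‖x - y‖) ∨
      (∀ k ≤ n, ∀ z w, |U k z - U k w| ≤ L * ‖gridPoint h z - gridPoint h w‖))
    {k : ℕ} (hk : k ≤ n) (z : Fin d → ℤ) :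
    v (k * τ) (gridPoint h z) - U k z ≤ errorConst d N K * (1 + T) * (1 + L) * √h := by
  have hd : (1 : ℝ) ≤ d := by exact_mod_cast hp.one_le_d
  have hN := hp.one_le_N
  have hN0 : 0 < N := by linarith
  obtain ⟨c₁, hc₁⟩ : ∃ c₁, c₁ = K * ((d : ℝ) + 6) := ⟨_, rfl⟩
  obtain ⟨c₂, hc₂⟩ : ∃ c₂, c₂ = N * (d : ℝ) + 1 := ⟨_, rfl⟩
  obtain ⟨r, hr⟩ : ∃ r, r = √h := ⟨_, rfl⟩
  obtain ⟨c₃, hc₃⟩ : ∃ c₃, c₃ = K * (d + 4)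
    + (K * (1 + d * K) + 2 * d * N * K) * (c₂ + K * (d + 5) + c₁) := ⟨_, rfl⟩
  obtain ⟨c₄, hc₄⟩ : ∃ c₄, c₄ = K * (d + 5) * (2 * c₁ + c₂ + d + 5) + c₂ + 1 := ⟨_, rfl⟩
  have hr0 : 0 < r := hr ▸ Real.sqrt_pos.2 hp.h_pos
  have hr2 : r ^ 2 = h := hr ▸ Real.sq_sqrt hp.h_pos.le
  have hc₁0 : 0 ≤ c₁ := by rw [hc₁]; positivity
  have hc₂0 : 0 ≤ c₂ := by rw [hc₂]; positivity
  have hc₃0 : 0 ≤ c₃ := by rw [hc₃]; positivity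
  have hc₄0 : 0 ≤ c₄ := by rw [hc₄]; positivity
  -- With this choice the momentum is `O(1 + L)`, the consistency error `h / ε` equals `(1 + L) r`,
  -- and the variables are `O(r)` apart.
  obtain ⟨ε, hε⟩ : ∃ ε, ε = r / (1 + L) := ⟨_, rfl⟩
  have hε0 : 0 < ε := by rw [hε]; positivity
  have hεr : ε * (1 + L) = r := by rw [hε]; field_simp
  obtain ⟨κ, hκ⟩ : ∃ κ, κ = c₁ * r := ⟨_, rfl⟩
  obtain ⟨l, hl⟩ : ∃ l, l = c₄ * (1 + L) * r := ⟨_, rfl⟩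
  obtain ⟨s, hs⟩ : ∃ s, s = min (1 / 2) ((1 + L) * r / (8 * N * d)) := ⟨_, rfl⟩
  have hs0 : 0 < s := by rw [hs]; exact lt_min (by norm_num) (by positivity)
  have hl0 : 0 ≤ l := by rw [hl]; positivity
  obtain ⟨B, hB⟩ := hv.bounded
  have hTm : T ∈ Icc 0 T := ⟨hT.le, le_rfl⟩
  have hspeed : 0 ≤ K * (1 + d * K) + 2 * d * N * K := by positivity
  have hUB : ∀ k ≤ n, ∀ z, |U k z| ≤ B + (K * (1 + d * K) + 2 * d * N * K) * T := by
    intro k hk z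
    have h1 := hU.abs_sub_terminal_le hp hH hK hq hk z
    have h2 := hB T hTm (gridPoint h z)
    rw [hv.terminal] at h2
    have h3 := abs_sub_abs_le_abs_sub (U k z) (q (gridPoint h z))
    have h4 : 0 ≤ (K * (1 + d * K) + 2 * d * N * K) * (k * τ) := by
      have := hp.τ_pos
      positivity
    linarith
  have hvB : ∀ t ∈ Icc 0 T, ∀ x, |v t x| ≤ B + (K * (1 + d * K) + 2 * d * N * K) * T :=
    fun t ht x => (hB t ht x).trans (le_add_of_nonneg_right (by positivity))
  have hpos : ∀ t ∈ Ioc 0 T, v t (gridPoint h z) - U k z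
      ≤ c₃ * r + (t - (k * τ + κ)) ^ 2 / (2 * ε) + l * (T - t) := by
    intro t₁ ht₁
    refine le_of_forall_pos_le_add fun η hη => ?_
    obtain ⟨δ, P, R, hδ0, hδ, hP, hR, t, ht, x, k', hk', z', hx, hmax, hle⟩ :=
      hv.exists_penalized_max (τ := τ) (κ := κ) hp.h_pos hvB hUB hε0 hl0 hs0 (half_pos hη)
        (show 0 < 1 / (4 * ε) by positivity) ht₁ hk z
    have := hv.le_of_penalized_max hp hH hK hq hU hc₁ hc₂ hr0 hr2 hε0 hL hεr hκ
      (by rw [hl, hc₄]) hs hδ0 hδ hP hR ht hk' hx hlip hmax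
    rw [← hc₃] at this
    linarith
  -- The doubling argument needs a positive time; continuity of `v` covers `k = 0`.
  have hlim : v (k * τ) (gridPoint h z) - U k z
      ≤ c₃ * r + (k * τ - (k * τ + κ)) ^ 2 / (2 * ε) + l * (T - k * τ) := by
    have hmem := hp.mem_Icc hk
    have hcont : ContinuousOn (fun t => v t (gridPoint h z) - U k z) (Icc 0 T) :=
      (hv.cont.comp (f := fun t : ℝ => (t, (gridPoint h z : Eucl d))) (by fun_prop)
        fun t ht => ⟨ht, mem_univ _⟩).sub continuousOn_const
    have hclos : closure (Ioc 0 T) = Icc 0 T := closure_Ioc hT.ne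
    refine ContinuousWithinAt.closure_le (hclos ▸ hmem)
      ((hcont _ hmem).mono Ioc_subset_Icc_self)
      (g := fun t => c₃ * r + (t - (k * τ + κ)) ^ 2 / (2 * ε) + l * (T - t))
      (Continuous.continuousWithinAt (by fun_prop)) hpos
  -- The price of the time shift.
  have e1 : (k * τ - (k * τ + κ)) ^ 2 / (2 * ε) = c₁ ^ 2 / 2 * (1 + L) * r := by
    rw [hκ, hε, sub_add_cancel_left]; field_simp
  have e2 : l * (T - k * τ) ≤ c₄ * (1 + L) * r * T := by
    rw [← hl]
    have : 0 ≤ (k : ℝ) * τ := (hp.mem_Icc hk).1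
    gcongr
    exact sub_le_self _ this
  have e3 : errorConst d N K = c₃ + c₁ ^ 2 / 2 + c₄ := by
    rw [errorConst, hc₃, hc₄, hc₂, hc₁]
  rw [e1] at hlim
  rw [e3, ← hr]
  have f1 : 0 ≤ c₃ * r * L := by positivity
  have f2 : 0 ≤ (c₃ + c₁ ^ 2 / 2) * (1 + L) * r * T := by positivity
  have f3 : 0 ≤ c₄ * (1 + L) * r := by positivity
  linarith

end ErrorBound

/-! ### The gradient supremum as a Lipschitz constant. -/

open MeasureTheory in
/-- A Lipschitz function whose gradient is bounded by `L` has Lipschitz constant `L`. By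
Rademacher's theorem this can be seen by averaging over translations. -/
theorem sub_le_of_norm_gradient_le {d : ℕ} {f : Eucl d → ℝ} {M : NNReal} (hf : LipschitzWith M f)
    {L : ℝ} (hL : ∀ x, ‖∇ f x‖ ≤ L) (x y : Eucl d) : f y - f x ≤ L * ‖y - x‖ := by
  refine le_of_forall_pos_le_add fun η hη => ?_
  set e := y - x with he
  obtain ⟨ρ, hρ, hMρ⟩ : ∃ ρ : ℝ, 0 < ρ ∧ 2 * M * ρ ≤ η :=
    ⟨η / (2 * M + 1), by positivity, by
      rw [← mul_div_assoc, div_le_iff₀ (by positivity)]; linarith⟩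
  -- A single segment may consist of points of nondifferentiability; averaging over translates by a
  -- small ball lets differentiability almost everywhere suffice.
  set μ : Measure (Eucl d) := volume.restrict (Metric.ball 0 ρ) with hμ
  have : IsFiniteMeasure μ := ⟨by
    rw [hμ, Measure.restrict_apply_univ]; exact measure_ball_lt_top⟩
  have hm : 0 < μ.real univ := by
    rw [hμ, measureReal_restrict_apply_univ]
    exact ENNReal.toReal_pos (Metric.measure_ball_pos _ _ hρ).ne' measure_ball_lt_top.ne
  set F : ℝ → Eucl d → ℝ := fun s z => f (z + (x + s • e)) with hF
  have hFlip : ∀ s, LipschitzWith M (F s) := fun s =>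
    LipschitzWith.of_dist_le_mul fun z w => by
      simpa using hf.dist_le_mul (z + (x + s • e)) (w + (x + s • e))
  have hFint : ∀ s, Integrable (F s) μ := fun s =>
    ((hFlip s).continuous.locallyIntegrable.integrableOn_isCompact
      (isCompact_closedBall 0 ρ)).mono_set Metric.ball_subset_closedBall
  have hgrad : ∀ w, ‖fderiv ℝ f w e‖ ≤ L * ‖e‖ := fun w => by
    refine ((fderiv ℝ f w).le_opNorm e).trans ?_
    gcongr
    simpa [gradient] using hL w
  have hderiv : ∀ s, HasDerivAt (fun s => ∫ z, F s z ∂μ)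
      (∫ z, fderiv ℝ f (z + (x + s • e)) e ∂μ) s := by
    intro s
    refine (hasDerivAt_integral_of_dominated_loc_of_lip (bound := fun _ => M * ‖e‖)
      Filter.univ_mem (Filter.Eventually.of_forall fun s => (hFint s).aestronglyMeasurable)
      (hFint s) ?_ ?_ (integrable_const _) ?_).2
    · exact ((measurable_fderiv_apply_const ℝ f e).comp
        (measurable_id.add_const _)).aestronglyMeasurable
    · refine Filter.Eventually.of_forall fun z => LipschitzOnWith.of_dist_le_mul fun a _ b _ => ?_
      refine (hf.dist_le_mul _ _).trans (le_of_eq ?_)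
      rw [dist_add_left, dist_add_left, dist_eq_norm, ← sub_smul, norm_smul, dist_eq_norm]
      simp only [Real.coe_nnabs, Real.norm_eq_abs, abs_mul, abs_norm, NNReal.abs_eq]
      ring
    · have h1 := (measurePreserving_add_right volume (x + s • e)).quasiMeasurePreserving.ae
        hf.ae_differentiableAt
      filter_upwards [ae_restrict_of_ae h1] with z hz
      have h2 : HasDerivAt (fun s : ℝ => z + (x + s • e)) e s := by
        simpa using (((hasDerivAt_id s).smul_const e).const_add x).const_add z
      exact hz.hasFDerivAt.comp_hasDerivAt s h2
  have hmv := norm_image_sub_le_of_norm_deriv_le_segment_01' (C := L * ‖e‖ * μ.real univ)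
    (fun s _ => (hderiv s).hasDerivWithinAt)
    (fun s _ => norm_integral_le_of_norm_le_const (Filter.Eventually.of_forall fun z => hgrad _))
  -- Each endpoint moves by at most `ρ`, so averaging costs at most `2 M ρ`.
  have hlow : (f y - f x - 2 * M * ρ) * μ.real univ ≤ ∫ z, F 1 z ∂μ - ∫ z, F 0 z ∂μ := by
    rw [← integral_sub (hFint 1) (hFint 0), mul_comm, ← smul_eq_mul, ← integral_const]
    refine integral_mono_ae (integrable_const _) ((hFint 1).sub (hFint 0)) ?_
    filter_upwards [ae_restrict_mem measurableSet_ball] with z hz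
    have h1 := hf.dist_le_mul (z + (x + (1 : ℝ) • e)) y
    have h2 := hf.dist_le_mul (z + (x + (0 : ℝ) • e)) x
    have e1 : z + (x + (1 : ℝ) • e) = z + y := by rw [he]; simp
    have e2 : z + (x + (0 : ℝ) • e) = z + x := by simp
    rw [e1, dist_add_self_left, Real.dist_eq] at h1
    rw [e2, dist_add_self_left, Real.dist_eq] at h2
    have h3 : M * ‖z‖ ≤ M * ρ := by
      gcongr; exact (mem_ball_zero_iff.1 hz).le
    simp only [hF, e1, e2]
    linarith [(abs_le.1 h1).1, (abs_le.1 h2).2]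
  have h4 : (f y - f x - 2 * M * ρ) * μ.real univ ≤ L * ‖e‖ * μ.real univ :=
    hlow.trans ((le_abs_self _).trans hmv)
  have h5 := le_of_mul_le_mul_right h4 hm
  linarith

/-- If the functions `v(t,·)` are uniformly Lipschitz, then `gradSup` is a common Lipschitz
constant and is at most any other one. -/
theorem abs_sub_le_gradSup {d : ℕ} {T : ℝ} {v : ℝ → Eucl d → ℝ} {M : NNReal}
    (hv : ∀ t ∈ Icc (0 : ℝ) T, LipschitzWith M (v t)) {t : ℝ} (ht : t ∈ Icc 0 T) (x y : Eucl d) :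
    |v t x - v t y| ≤ gradSup T v * ‖x - y‖ := by
  have hbdd : BddAbove (range fun z : Icc (0 : ℝ) T × Eucl d => ‖∇ (v z.1) z.2‖) := by
    refine ⟨M, ?_⟩
    rintro _ ⟨z, rfl⟩
    simpa [gradient] using norm_fderiv_le_of_lipschitz ℝ (hv z.1 z.1.2)
  have hL : ∀ w, ‖∇ (v t) w‖ ≤ gradSup T v := fun w =>
    le_ciSup hbdd ((⟨t, ht⟩, w) : Icc (0 : ℝ) T × Eucl d)
  have h1 := sub_le_of_norm_gradient_le (hv t ht) hL x y
  have h2 := sub_le_of_norm_gradient_le (hv t ht) hL y x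
  rw [norm_sub_rev] at h1
  exact abs_le.2 ⟨by linarith, by linarith⟩

theorem gradSup_nonneg {d : ℕ} (T : ℝ) (v : ℝ → Eucl d → ℝ) : 0 ≤ gradSup T v :=
  Real.iSup_nonneg fun _ => norm_nonneg _

theorem abs_ciInf_sub_ciInf_le {ι : Type*} [Nonempty ι] {f g : ι → ℝ} (hf : BddBelow (range f))
    (hg : BddBelow (range g)) {b : ℝ} (h : ∀ i, |f i - g i| ≤ b) :
    |(⨅ i, f i) - ⨅ i, g i| ≤ b := by
  have h1 : (⨅ i, f i) - b ≤ ⨅ i, g i := le_ciInf fun i => by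
    linarith [ciInf_le hf i, (abs_le.1 (h i)).2]
  have h2 : (⨅ i, g i) - b ≤ ⨅ i, f i := le_ciInf fun i => by
    linarith [ciInf_le hg i, (abs_le.1 (h i)).1]
  exact abs_le.2 ⟨by linarith, by linarith⟩

/-- The `ℓ¹` norm of the momentum is what the coordinatewise viscosity can absorb in `step_mono`. -/
theorem abs_inner_le_sum {d : ℕ} (p f : Eucl d) : |⟪p, f⟫_ℝ| ≤ ‖f‖ * ∑ i, |p i| := by
  rw [PiLp.inner_apply, Finset.mul_sum]
  refine (Finset.abs_sum_le_sum_abs _ _).trans (Finset.sum_le_sum fun i _ => ?_)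
  have : |f i| ≤ ‖f‖ := PiLp.norm_apply_le f i
  simp only [RCLike.inner_apply, conj_trivial, abs_mul]
  gcongr

/-! ### Bounds for the Hamiltonian. -/

section Hamiltonian

variable {d m : ℕ} {T K N : ℝ} {A : Set (Eucl m)} {c : ℝ → Eucl d → Eucl m → ℝ}
  {f : ℝ → Eucl d → Eucl m → Eucl d} {q : Eucl d → ℝ}

theorem DataBounds.abs_cost_le (hD : DataBounds T K A c f q) {t : ℝ} (ht : t ∈ Icc 0 T)
    (x p : Eucl d) {a : Eucl m} (ha : a ∈ A) :
    |c t x a + ⟪p, f t x a⟫_ℝ| ≤ K * (1 + ‖p‖) := by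
  refine (abs_add_le _ _).trans ?_
  have h1 := hD.c_bound t ht x a ha
  have h2 := abs_real_inner_le_norm p (f t x a)
  have h3 : ‖p‖ * ‖f t x a‖ ≤ ‖p‖ * K := by gcongr; exact hD.f_bound t ht x a ha
  linarith

theorem DataBounds.bddBelow (hD : DataBounds T K A c f q) {t : ℝ} (ht : t ∈ Icc 0 T)
    (x p : Eucl d) : BddBelow (range fun a : A => c t x a + ⟪p, f t x a⟫_ℝ) := by
  refine ⟨-(K * (1 + ‖p‖)), ?_⟩
  rintro _ ⟨a, rfl⟩
  exact (abs_le.1 (hD.abs_cost_le ht x p a.2)).1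

/-- Each bound holds for every control separately and passes to the infimum. The momentum constant
`2N` comes from `‖f‖ / 2 ≤ N`. -/
theorem DataBounds.hamiltonianBounds (hD : DataBounds T K A c f q) (hA : A.Nonempty)
    (hf : ∀ t ∈ Icc (0 : ℝ) T, ∀ x, ∀ a ∈ A, ‖f t x a‖ / 2 ≤ N) :
    HamiltonianBounds T K N (hamiltonian A c f) := by
  have : Nonempty A := hA.to_subtype
  refine ⟨fun t ht x p => ?_, fun t ht s hs x y p => ?_, fun t ht x p r => ?_⟩
  · have h0 : BddBelow (range fun _ : A => (0 : ℝ)) := ⟨0, by rintro _ ⟨_, rfl⟩; exact le_rfl⟩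
    simpa [hamiltonian] using abs_ciInf_sub_ciInf_le (hD.bddBelow ht x p) h0
      (b := K * (1 + ‖p‖)) fun a => by simpa using hD.abs_cost_le ht x p a.2
  · refine abs_ciInf_sub_ciInf_le (hD.bddBelow ht x p) (hD.bddBelow hs y p) fun a => ?_
    have h1 := hD.c_lip t ht s hs x y a a.2 a a.2
    have h2 := hD.f_lip t ht s hs x y a a.2 a a.2
    rw [sub_self, norm_zero, add_zero] at h1 h2
    have h3 := abs_real_inner_le_norm p (f t x a - f s y a)
    have h4 : ‖p‖ * ‖f t x a - f s y a‖ ≤ ‖p‖ * (K * (|t - s| + ‖x - y‖)) := by gcongr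
    rw [add_sub_add_comm, ← inner_sub_right]
    refine (abs_add_le _ _).trans ?_
    linarith
  · refine abs_ciInf_sub_ciInf_le (hD.bddBelow ht x p) (hD.bddBelow ht x r) fun a => ?_
    have h1 : ‖f t x a‖ ≤ 2 * N := by linarith [hf t ht x a a.2]
    rw [add_sub_add_left_eq_sub, ← inner_sub_left]
    refine (abs_inner_le_sum _ _).trans ?_
    simp only [PiLp.sub_apply]
    gcongr

end Hamiltonian

/-! ### Sign change and the two-sided bound. -/

section Reflection

variable {d n : ℕ} {T τ h N K : ℝ} {H : ℝ → Eucl d → Eucl d → ℝ} {q : Eucl d → ℝ}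
  {v : ℝ → Eucl d → ℝ} {U : ℕ → (Fin d → ℤ) → ℝ}

/-- The Hamiltonian `-H(t,x,-p)` governs `-v` and `-U`, so the one-sided bound applied to them
yields the other half. -/
theorem HamiltonianBounds.neg (hH : HamiltonianBounds T K N H) :
    HamiltonianBounds T K N (fun t x p => -H t x (-p)) := by
  refine ⟨fun t ht x p => ?_, fun t ht s hs x y p => ?_, fun t ht x p r => ?_⟩
  · simpa using hH.bound t ht x (-p)
  · rw [neg_sub_neg, abs_sub_comm]
    simpa using hH.lip t ht s hs x y (-p)
  · rw [neg_sub_neg, abs_sub_comm]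
    refine (hH.lip_momentum t ht x (-p) (-r)).trans (le_of_eq ?_)
    congr 1
    refine Finset.sum_congr rfl fun i _ => ?_
    rw [PiLp.neg_apply, PiLp.neg_apply, neg_sub_neg, abs_sub_comm]

theorem IsLatticeSolution.neg (hU : IsLatticeSolution n τ h N H q U) :
    IsLatticeSolution n τ h N (fun t x p => -H t x (-p)) (fun x => -q x) (fun k z => -U k z) := by
  refine ⟨fun k hk z => ?_, fun z => by rw [hU.terminal]⟩
  have h1 : latGrad h (fun z => -U (k + 1) z) z = -latGrad h (U (k + 1)) z := by
    ext i; simp only [latGrad, PiLp.neg_apply]; ring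
  have h2 : latLap h (fun z => -U (k + 1) z) z = -latLap h (U (k + 1)) z := by
    rw [latLap, latLap, ← Finset.sum_neg_distrib]
    exact Finset.sum_congr rfl fun i _ => by ring
  rw [hU.eqn k hk z, step, step, h1, h2, neg_neg]
  ring

theorem IsViscositySolution.isSubsolution (hv : IsViscositySolution T H q v) :
    IsSubsolution T H q v :=
  ⟨hv.cont, hv.bounded, hv.terminal, hv.sub⟩

theorem IsViscositySolution.isSubsolution_neg (hv : IsViscositySolution T H q v) :
    IsSubsolution T (fun t x p => -H t x (-p)) (fun x => -q x) (fun t x => -v t x) := by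
  refine ⟨hv.cont.neg, by simpa using hv.bounded, fun x => by rw [hv.terminal],
    fun φ hφ t ht x hmax => ?_⟩
  have h1 := hv.super (fun z => -φ z) hφ.neg t ht x (by
    filter_upwards [hmax] with z hz
    linarith)
  have h2 : ∇ (fun y => -φ (t, y)) x = -∇ (fun y => φ (t, y)) x := by
    simp [gradient, fderiv_fun_neg]
  rw [h2, deriv.fun_neg] at h1
  linarith

/-- Two-sided error bound in terms of a spatial Lipschitz constant of the solution or of the
scheme. -/
theorem IsViscositySolution.abs_sub_le (hp : Parameters d n T τ h N) (hT : 0 < T)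
    (hH : HamiltonianBounds T K N H) (hK : 0 ≤ K) (hq : ∀ x y, |q x - q y| ≤ K * ‖x - y‖)
    (hv : IsViscositySolution T H q v) (hU : IsLatticeSolution n τ h N H q U) {L : ℝ} (hL : 0 ≤ L)
    (hlip : (∀ t ∈ Icc 0 T, ∀ x y, |v t x - v t y| ≤ L * ‖x - y‖) ∨
      (∀ k ≤ n, ∀ z w, |U k z - U k w| ≤ L * ‖gridPoint h z - gridPoint h w‖))
    {k : ℕ} (hk : k ≤ n) (z : Fin d → ℤ) :
    |v (k * τ) (gridPoint h z) - U k z| ≤ errorConst d N K * (1 + T) * (1 + L) * √h := by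
  have h1 := hv.isSubsolution.sub_le hp hT hH hK hq hU hL hlip hk z
  have h2 := hv.isSubsolution_neg.sub_le hp hT hH.neg hK
    (fun x y => by rw [neg_sub_neg, abs_sub_comm]; exact hq x y) hU.neg hL
    (hlip.imp (fun h t ht x y => by rw [neg_sub_neg, abs_sub_comm]; exact h t ht x y)
      (fun h k hk z w => by rw [neg_sub_neg, abs_sub_comm]; exact h k hk z w)) hk z
  exact abs_le.2 ⟨by linarith, h1⟩

end Reflection

/-! ### Lipschitz continuity of the viscosity solution. -/

section Lipschitz

variable {d n : ℕ} {T τ h N K : ℝ} {H : ℝ → Eucl d → Eucl d → ℝ} {q : Eucl d → ℝ}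
  {v : ℝ → Eucl d → ℝ}

theorem exists_isLatticeSolution (n : ℕ) (τ h N : ℝ) (H : ℝ → Eucl d → Eucl d → ℝ)
    (q : Eucl d → ℝ) : ∃ U, IsLatticeSolution n τ h N H q U := by
  -- Here `j` counts steps back from the terminal time, so `H` is evaluated at the later time `(n -
  -- j) τ`.
  let W : ℕ → (Fin d → ℤ) → ℝ := fun j => Nat.rec (fun z => q (gridPoint h z))
    (fun j g => step τ h N H ((n - j : ℕ) * τ) g) j
  refine ⟨fun k => W (n - k), fun k hk z => ?_, fun z => by simp [W]⟩
  have h1 : n - k = n - (k + 1) + 1 := by omega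
  have h2 : n - (n - (k + 1)) = k + 1 := by omega
  have h3 : W (n - (k + 1) + 1)
      = step τ h N H ((n - (n - (k + 1)) : ℕ) * τ) (W (n - (k + 1))) := rfl
  rw [h2] at h3
  simp only [h1, h3]

/-- Viscosity solutions are limits of the scheme, hence Lipschitz continuous in space. -/
theorem IsViscositySolution.lipschitz (hd : 1 ≤ d) (hN : 1 ≤ N) (hT : 0 < T)
    (hH : HamiltonianBounds T K N H) (hK : 0 ≤ K) (hq : ∀ x y, |q x - q y| ≤ K * ‖x - y‖)
    (hv : IsViscositySolution T H q v) {t : ℝ} (ht : t ∈ Icc 0 T) (x y : Eucl d) :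
    |v t x - v t y| ≤ (1 + d * K) * Real.exp (K * d * T) * ‖x - y‖ := by
  have hd' : (1 : ℝ) ≤ d := by exact_mod_cast hd
  obtain ⟨L, hLdef⟩ : ∃ L, L = (1 + d * K) * Real.exp (K * d * T) := ⟨_, rfl⟩
  have hL : 0 ≤ L := by rw [hLdef]; positivity
  have approx : ∀ η > 0, ∃ s ∈ Icc 0 T, ∃ x' y' : Eucl d, |s - t| ≤ η ∧ ‖x' - x‖ ≤ η ∧
      ‖y' - y‖ ≤ η ∧ |v s x' - v s y'| ≤ η + L * ‖x' - y'‖ := by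
    intro η hη
    set E := errorConst d N K * (1 + T) * (1 + L) with hE
    have hE0 : 0 < E := by
      have := errorConst_pos d (N := N) (by linarith) hK
      positivity
    set h₀ := min 1 (min (η / d) ((η / (2 * E)) ^ 2)) with hh₀
    have hh₀0 : 0 < h₀ := lt_min one_pos (lt_min (by positivity) (by positivity))
    obtain ⟨j, hj⟩ := exists_nat_gt (2 * d * N * T / h₀)
    have hj0 : (0 : ℝ) < j := lt_of_le_of_lt (by positivity) hj
    -- With `τ = T / j`, this is equality in the CFL condition.
    set h := 2 * d * N * T / j with hh
    have hle : h ≤ h₀ := by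
      rw [hh, div_le_iff₀ hj0]
      rw [div_lt_iff₀ hh₀0] at hj
      linarith
    have hp : Parameters d j T (T / j) h N :=
      ⟨hd, hN, by positivity, by positivity, hle.trans (min_le_left _ _), by field_simp,
        le_of_eq (by rw [hh]; ring)⟩
    have hdh : d * h ≤ η := by
      have h1 : h ≤ η / d := hle.trans ((min_le_right _ _).trans (min_le_left _ _))
      rwa [le_div_iff₀ (by positivity), mul_comm] at h1
    have hτη : T / j ≤ η := by
      have := hp.h_pos
      nlinarith [hp.τ_le]
    have hsq : 2 * (E * √h) ≤ η := by
      have h1 : h ≤ (η / (2 * E)) ^ 2 := hle.trans ((min_le_right _ _).trans (min_le_right _ _))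
      have h2 : √h ≤ η / (2 * E) := Real.sqrt_le_iff.2 ⟨by positivity, h1⟩
      rw [le_div_iff₀ (by positivity)] at h2
      linarith
    obtain ⟨U, hU⟩ := exists_isLatticeSolution j (T / j) h N H q
    have hUlip : ∀ k ≤ j, ∀ z w, |U k z - U k w| ≤ L * ‖gridPoint h z - gridPoint h w‖ :=
      fun k hk z w => hLdef ▸ hU.lipschitz hp hH hK hq hk z w
    obtain ⟨z, hz⟩ := exists_gridPoint_near hp.h_pos x
    obtain ⟨w, hw⟩ := exists_gridPoint_near hp.h_pos y
    have hquot : 0 ≤ t / (T / j) := div_nonneg ht.1 hp.τ_pos.le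
    have hk : ⌊t / (T / j)⌋₊ ≤ j := by
      refine Nat.floor_le_of_le ?_
      rw [div_le_iff₀ hp.τ_pos, ← hp.T_eq]
      exact ht.2
    refine ⟨⌊t / (T / j)⌋₊ * (T / j), hp.mem_Icc hk, gridPoint h z, gridPoint h w, ?_,
      by rw [norm_sub_rev]; exact hz.trans hdh, by rw [norm_sub_rev]; exact hw.trans hdh, ?_⟩
    · have h1 := Nat.floor_le hquot
      have h2 := Nat.lt_floor_add_one (t / (T / j))
      rw [le_div_iff₀ hp.τ_pos] at h1
      rw [div_lt_iff₀ hp.τ_pos] at h2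
      exact abs_le.2 ⟨by linarith, by linarith⟩
    -- The Lipschitz alternative is taken for the scheme, so nothing about `v` is presupposed.
    · have h1 := abs_le.1 (hv.abs_sub_le hp hT hH hK hq hU hL (Or.inr hUlip) hk z)
      have h2 := abs_le.1 (hv.abs_sub_le hp hT hH hK hq hU hL (Or.inr hUlip) hk w)
      have h3 := abs_le.1 (hUlip _ hk z w)
      rw [← hE] at h1 h2
      exact abs_le.2 ⟨by linarith, by linarith⟩
  rw [← hLdef]
  refine le_of_forall_pos_le_add fun η hη => ?_
  have cont : ∀ w : Eucl d, ∃ δ > 0, ∀ s ∈ Icc 0 T, ∀ w' : Eucl d, |s - t| < δ → ‖w' - w‖ < δ →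
      |v s w' - v t w| < η / 4 := by
    intro w
    obtain ⟨δ, hδ, hδw⟩ := Metric.continuousWithinAt_iff.1
      (hv.cont (t, w) ⟨ht, mem_univ _⟩) (η / 4) (by positivity)
    refine ⟨δ, hδ, fun s hs w' h1 h2 => ?_⟩
    have := hδw (x := (s, w')) ⟨hs, mem_univ _⟩ (by
      rw [Prod.dist_eq, max_lt_iff, dist_eq_norm w']
      exact ⟨h1, h2⟩)
    rwa [Real.dist_eq] at this
  obtain ⟨δ₁, hδ₁, hx⟩ := cont x
  obtain ⟨δ₂, hδ₂, hy⟩ := cont y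
  set θ := min (min (δ₁ / 2) (δ₂ / 2)) (η / (2 * (1 + 2 * L))) with hθ
  have hθ0 : 0 < θ := lt_min (lt_min (by positivity) (by positivity)) (by positivity)
  obtain ⟨s, hs, x', y', hst, hxx, hyy, hxy⟩ := approx θ hθ0
  have hθ1 : θ < δ₁ := by
    have : θ ≤ δ₁ / 2 := (min_le_left _ _).trans (min_le_left _ _)
    linarith
  have hθ2 : θ < δ₂ := by
    have : θ ≤ δ₂ / 2 := (min_le_left _ _).trans (min_le_right _ _)
    linarith
  have hθ3 : θ * (2 * (1 + 2 * L)) ≤ η := by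
    rw [← le_div_iff₀ (by positivity)]; exact min_le_right _ _
  have a1 := abs_lt.1 (hx s hs x' (hst.trans_lt hθ1) (hxx.trans_lt hθ1))
  have a2 := abs_lt.1 (hy s hs y' (hst.trans_lt hθ2) (hyy.trans_lt hθ2))
  have a3 := abs_le.1 hxy
  have a4 : ‖x' - y'‖ ≤ ‖x - y‖ + 2 * θ := by
    have : x' - y' = (x' - x) + (x - y) + (y - y') := by abel
    rw [this]
    refine (norm_add₃_le).trans ?_
    rw [norm_sub_rev y y']
    linarith
  have a5 : L * ‖x' - y'‖ ≤ L * (‖x - y‖ + 2 * θ) := by gcongr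
  exact abs_le.2 ⟨by linarith, by linarith⟩

end Lipschitz

/-! ### From the grid to the lattice, and conclusion. -/

/-- Restricting a solution of the scheme to the grid gives a lattice solution. -/
theorem IsSchemeSolution.isLatticeSolution {d n : ℕ} {T τ h N : ℝ}
    {H : ℝ → Eucl d → Eucl d → ℝ} {q : Eucl d → ℝ} {V : ℝ → Eucl d → ℝ}
    (hp : Parameters d n T τ h N) (hV : IsSchemeSolution T τ h N H q V) :
    IsLatticeSolution n τ h N H q (fun k z => V (k * τ) (gridPoint h z)) := by
  have hgrid : ∀ z, gridPoint h z ∈ spaceGrid d h := fun z i => ⟨z i, rfl⟩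
  have hτ := hp.τ_pos
  refine ⟨fun k hk z => ?_, fun z => by rw [← hp.T_eq]; exact hV.terminal _ (hgrid z)⟩
  have h1 := hV.eqn ((k + 1 : ℕ) * τ)
    ⟨⟨hp.mem_Icc (Nat.succ_le_of_lt hk), k + 1, rfl⟩, by
      simp only [mem_singleton_iff]; positivity⟩ _ (hgrid z)
  have h2 : ((k + 1 : ℕ) : ℝ) * τ - τ = k * τ := by push_cast; ring
  have h3 : discGrad h (V ((k + 1 : ℕ) * τ)) (gridPoint h z)
      = latGrad h (fun z => V ((k + 1 : ℕ) * τ) (gridPoint h z)) z := by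
    ext i; simp only [discGrad, latGrad, gridPoint_add, gridPoint_sub, gridPoint_single]
  have h4 : discLaplacian h (V ((k + 1 : ℕ) * τ)) (gridPoint h z)
      = latLap h (fun z => V ((k + 1 : ℕ) * τ) (gridPoint h z)) z := by
    simp only [discLaplacian, latLap, gridPoint_add, gridPoint_sub, gridPoint_single]
  rw [h2, h3, h4] at h1
  rw [step]
  have h5 : V ((k + 1 : ℕ) * τ) (gridPoint h z) - V (k * τ) (gridPoint h z)
      = τ * ((V ((k + 1 : ℕ) * τ) (gridPoint h z) - V (k * τ) (gridPoint h z)) / τ) := by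
    field_simp
  rw [eq_sub_of_add_eq h1] at h5
  linarith

end HJB

theorem theorem4p3 (d : ℕ) (hd : 1 ≤ d) (N K : ℝ) (hN : 1 ≤ N) :
    ∃ C : ℝ, 0 < C ∧
      ∀ (m : ℕ) (A : Set (HJB.Eucl m)) (T τ h : ℝ)
        (c : ℝ → HJB.Eucl d → HJB.Eucl m → ℝ)
        (f : ℝ → HJB.Eucl d → HJB.Eucl m → HJB.Eucl d)
        (q : HJB.Eucl d → ℝ)
        (α : ℝ → HJB.Eucl d → HJB.Eucl d → HJB.Eucl m)
        (v V : ℝ → HJB.Eucl d → ℝ),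
        IsCompact A →
        HJB.DataBounds T K A c f q →
        HJB.IsLipschitzArgmin T K A c f α →
        τ ∈ Set.Ioo (0 : ℝ) 1 →
        h ∈ Set.Ioo (0 : ℝ) 1 →
        (∃ n : ℕ, 0 < n ∧ T = n * τ) →
        (∀ t ∈ Set.Icc (0 : ℝ) T, ∀ x, ∀ a ∈ A, ‖f t x a‖ / 2 ≤ N) →
        N ≤ h / (2 * d * τ) →
        HJB.IsViscositySolution T (HJB.hamiltonian A c f) q v →
        HJB.IsSchemeSolution T τ h N (HJB.hamiltonian A c f) q V →
        (∃ M : NNReal, ∀ t ∈ Set.Icc (0 : ℝ) T, LipschitzWith M (v t)) ∧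
        (∀ t ∈ HJB.timeGrid T τ, ∀ x ∈ HJB.spaceGrid d h,
          |v t x - V t x| ≤ C * (1 + T) * (1 + HJB.gradSup T v) * Real.sqrt h) ∧
        (∀ t ∈ HJB.timeGrid T τ, ∀ x ∈ HJB.spaceGrid d h,
          |v t x - V t x| ≤ C * Real.exp (C * T) * Real.sqrt h) := by
  rcases lt_or_ge K 0 with hK | hK
  -- A negative `K` contradicts the bound on `q`.
  · refine ⟨1, one_pos, fun m A T τ h c f q α v V _ hD => ?_⟩
    exact absurd ((abs_nonneg _).trans (hD.q_bound 0)) (not_le.2 hK)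
  have hE := HJB.errorConst_pos d (zero_le_one.trans hN) hK
  set E := HJB.errorConst d N K
  have hdK : 0 ≤ (d : ℝ) * K := by positivity
  refine ⟨1 + E * (2 + d * K) + (1 + K * d), by positivity,
    fun m A T τ h c f q α v V _ hD hα hτ hh hn hf hcfl hv hV => ?_⟩
  set C := 1 + E * (2 + d * K) + (1 + K * d) with hC
  have hd' : (1 : ℝ) ≤ d := by exact_mod_cast hd
  obtain ⟨n, hn, hTn⟩ := hn
  have hτ0 := hτ.1
  have hT : 0 < T := by rw [hTn]; positivity
  have hA : A.Nonempty := ⟨_, hα.mem 0 ⟨le_rfl, hT.le⟩ 0 0⟩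
  have hH := hD.hamiltonianBounds hA hf
  have hp : HJB.Parameters d n T τ h N := ⟨hd, hN, hτ.1, hh.1, hh.2.le, hTn, by
    rwa [le_div_iff₀ (by positivity), mul_comm] at hcfl⟩
  have hU := hV.isLatticeSolution hp
  have hlip : ∀ t ∈ Icc (0 : ℝ) T,
      LipschitzWith (Real.toNNReal ((1 + d * K) * Real.exp (K * d * T))) (v t) := fun t ht =>
    LipschitzWith.of_dist_le_mul fun x y => by
      rw [Real.coe_toNNReal _ (by positivity), Real.dist_eq, dist_eq_norm]
      exact hv.lipschitz hd hN hT hH hK hD.q_lip ht x y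
  have hpoint : ∀ t ∈ HJB.timeGrid T τ, ∀ x ∈ HJB.spaceGrid d h,
      ∃ k ≤ n, ∃ z, t = k * τ ∧ x = HJB.gridPoint h z := by
    rintro t ⟨ht, k, rfl⟩ x hx
    choose z hz using hx
    refine ⟨k, ?_, z, rfl, by ext i; exact hz i⟩
    have h1 := ht.2
    rw [hTn] at h1
    exact_mod_cast le_of_mul_le_mul_right h1 hτ0
  have hEC : E ≤ C := by nlinarith
  refine ⟨⟨_, hlip⟩, fun t ht x hx => ?_, fun t ht x hx => ?_⟩
  · obtain ⟨k, hk, z, rfl, rfl⟩ := hpoint t ht x hx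
    have hg := HJB.gradSup_nonneg T v
    refine (hv.abs_sub_le hp hT hH hK hD.q_lip hU hg
      (Or.inl fun t ht => HJB.abs_sub_le_gradSup hlip ht) hk z).trans ?_
    gcongr
  · obtain ⟨k, hk, z, rfl, rfl⟩ := hpoint t ht x hx
    refine (hv.abs_sub_le hp hT hH hK hD.q_lip hU (by positivity)
      (Or.inr fun k hk => hU.lipschitz hp hH hK hD.q_lip hk) hk z).trans ?_
    refine mul_le_mul_of_nonneg_right ?_ (Real.sqrt_nonneg h)
    have h1 : 1 ≤ Real.exp (K * d * T) := Real.one_le_exp (by positivity)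
    have h2 : 1 + T ≤ Real.exp T := by linarith [Real.add_one_le_exp T]
    -- The factor `1 + T` is absorbed into `exp T`, and the Lipschitz constant of the scheme
    -- supplies `exp (K d T)`.
    calc E * (1 + T) * (1 + (1 + d * K) * Real.exp (K * d * T))
        ≤ E * Real.exp T * (1 * Real.exp (K * d * T) + (1 + d * K) * Real.exp (K * d * T)) := by
          gcongr; linarith
      _ = E * (2 + d * K) * Real.exp ((1 + K * d) * T) := by
          rw [add_mul (1 : ℝ) (K * d) T, Real.exp_add, one_mul T]; ring
      _ ≤ C * Real.exp (C * T) := by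
          have h3 : 0 ≤ E * (2 + d * K) := by positivity
          have h4 : 0 ≤ K * d := by positivity
          gcongr <;> linarith
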